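/- **Setting.** Let $\Gamma=\mathrm{PGL}(2,\mathbb Z)$ act on the upper half-plane $\mathbb H$ and on $\mathbb P^1(\mathbb R)$ by Möbius transformations (composed with complex conjugation on $\mathbb H$ if the determinant is $-1$). Let $\Gamma_0(2)\subset\Gamma$ be the subgroup of the matrices $\begin{pmatrix}a&b\\c&d\end{pmatrix}$ with $c$ even, let $X_{\Gamma_0(2)}=\Gamma_0(2)\backslash\mathbb H$, and let $\mathbb P=\mathbb P^1(\mathbb F_2)=\{0=[0:1],\,1=[1:1],\,\infty=[1:0]\}\cong\Gamma/\Gamma_0(2)$, so that $X_{\Gamma_0(2)}\cong\Gamma\backslash(\mathbb H\times\mathbb P)$, the class of $(z,g\infty)$ corresponding to that of $g^{-1}z$. An infinite geodesic on $X_{\Gamma_0(2)}$ is the image of a complete geodesic of $\mathbb H$, parametrized by arc length; it does not end at cusps if neither end of such a lift is in $\mathbb P^1(\mathbb Q)$. A triple $(\omega^-,\omega^+,s)$ with $\omega^-\in(-\infty,-1]$, $\omega^+\in[0,1]$, $s\in\mathbb P$ codes a geodesic $\gamma$ if $\gamma$ is the image of a complete geodesic of $\mathbb H\times\{s\}$ running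 from $\omega^-$ to $\omega^+$. The generalized Gauss shift is, with $k=[1/\omega^+]$, $$T(\omega^-,\omega^+,s)=\Bigl(\tfrac1{\omega^-}-k,\ \tfrac1{\omega^+}-k,\ \begin{pmatrix}-k&1\\1&0\end{pmatrix}\cdot s\Bigr).$$ For $u\in\mathbb R$ let $p_1=\frac{-u}{1+u+u^2}$, $p_2=\frac{1+u}{1+u+u^2}$, $p_3=\frac{u(1+u)}{1+u+u^2}$. A (discretized) mixmaster universe consists of Kasner eras indexed by $n\in\mathbb Z$. Its state in a cycle is a parameter $u$ together with a naming of the three physical directions by $x,y,z$; the metric in the cycle is the Kasner metric $-dt^2+\sum_a t^{2p(a)}dx_a^2$ in which the directions named $x,y,z$ have the exponents $p_1,p_2,p_3$. Era $n$ starts with a parameter $u_n>1$; inside an era the state changes by steps $u\mapsto u-1$ together with the permutation $(12)(3)$ of the names $(x,y,z)$; when the parameter has fallen into the range $0<u<1$, the era ends with the bounce $u\mapsto1/u$ together with the permutation $(1)(23)$ of the names, and the result is the initial state of era $n+1$. Label the axes by $z\leftrightarrow 0$, $y\leftrightarrow\infty$, $x\leftrightarrow 1$ (a bijection with $\mathbb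 P$). A $\mathbb Z$-indexed orbit $(\omega^-_n,\omega^+_n,s_n)_{n\in\mathbb Z}$ of $T$ through triples coding $\gamma$ describes a mixmaster universe, relative to a chosen reference direction $a$, if for all $n$ one has $u_n=1/\omega_n^+$ and $s_n$ is the label of the name of $a$ at the beginning of era $n$. A geodesic $\gamma$ determines a universe if some such orbit describes it. **Theorem.** (a) The matrix $\begin{pmatrix}-k&1\\1&0\end{pmatrix}$, $k\in\mathbb Z$, acts on $\mathbb P$, with the above labels, as the permutation $(1)(23)$ of $(x,y,z)$ if $k$ is even, and as $(12)(3)$ followed by $(1)(23)$ if $k$ is odd. (b) $T$ is a bijection of the set of triples $(\omega^-,\omega^+,s)$ with irrational $\omega^-\in(-\infty,-1]$ and irrational $\omega^+\in[0,1]$. Each such triple codes an infinite geodesic on $X_{\Gamma_0(2)}$ that does not end at cusps. (c) Let $\gamma$ be an infinite geodesic on $X_{\Gamma_0(2)}$ that does not end at cusps. The triples coding $\gamma$ have irrational $\omega^\pm$ and form exactly one orbit $\{T^m(\omega^-,\omega^+,s):m\in\mathbb Z\}$. Another infinite geodesic not ending at cusps is coded by a common triple with $\gamma$ if and only if it is $t\mapsto\gamma(t+t_0)$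 for some $t_0\in\mathbb R$. (d) For every reference direction $a$, such a $\gamma$ determines a mixmaster universe. The universes that it determines are exactly the ones obtained from one of them by a shift of the numbering of the eras (the choice of the initial time) and a permutation of the three physical directions that fixes $a$. (e) For each universe determined by $\gamma$, described by the orbit $(\omega_n^-,\omega_n^+,s_n)$, put $k_n=[u_n]$, $x_n=1/u_n=\omega^+_n$. Then for all $n\in\mathbb Z$: the BKL transition $u_{n+1}=\dfrac1{u_n-[u_n]}$ holds, $(x_{n+1},s_{n+1})$ is the image of $(x_n,s_n)$ under the generalized Gauss shift $(x,s)\mapsto\Bigl(\tfrac1x-[\tfrac1x],\begin{pmatrix}-[1/x]&1\\1&0\end{pmatrix}\cdot s\Bigr)$, and the names of all three directions at the beginning of era $n+1$ arise from those at the beginning of era $n$ by the action of $\begin{pmatrix}-k_n&1\\1&0\end{pmatrix}$ on the labels. Era $n$ consists of the $k_n$ cycles with parameters $u_n-j>1$, $0\le j<k_n$, each with exponents satisfying $\sum_a p(a)=\sum_a p(a)^2=1$; after $k_n$ steps the bounce leads to era $n+1$. The second parameter $v_n=-\omega_n^-$ satisfies $v_{n+1}=[u_n]+1/v_n$. The continued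 fraction expansions are $\omega_n^+=[k_n,k_{n+1},\dots]$ and $-\omega_n^-=[k_{n-1};k_{n-2},k_{n-3},\dots]$. -/

import Mathlib

open Filter Topology
open scoped MatrixGroups UpperHalfPlane

namespace Mixmaster

/-! ### The group `PGL(2, ℤ)`, its subgroup `Γ₀(2)`, and the modular curve -/

/-- `PGL(2, ℤ)` acts on the upper half-plane through `PGL(2, ℝ)` (elements of determinant `-1`
act by `z ↦ (a z̄ + b) / (c z̄ + d)`). -/
noncomputable instance : MulAction PGL(2, ℤ) ℍ :=
  MulAction.compHom ℍ (Matrix.ProjGenLinGroup.map (n := Fin 2) (Int.castRingHom ℝ))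

/-- The projective line over the field with two elements. -/
abbrev P1F2 : Type := Projectivization (ZMod 2) (Fin 2 → ZMod 2)

/-- `PGL(2, ℤ)` acts on the projective line over `𝔽₂` by reduction modulo two. -/
noncomputable instance : MulAction PGL(2, ℤ) P1F2 :=
  MulAction.compHom P1F2 (Matrix.ProjGenLinGroup.map (n := Fin 2) (Int.castRingHom (ZMod 2)))

/-- The matrices `(a b; c d)` in `GL(2, ℤ)` with `c` even. -/
def gamma0GL : Subgroup (GL (Fin 2) ℤ) where
  carrier := {g | (2 : ℤ) ∣ g 1 0}
  one_mem' := by simp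
  mul_mem' := by
    intro a b ha hb
    have h : (a * b) 1 0 = a 1 0 * b 0 0 + a 1 1 * b 1 0 := by
      simp [Matrix.mul_apply, Fin.sum_univ_two]
    simp only [Set.mem_ofPred_eq] at ha hb ⊢
    rw [h]
    exact dvd_add (ha.mul_right _) (hb.mul_left _)
  inv_mem' := by
    intro a ha
    simp only [Set.mem_ofPred_eq] at ha ⊢
    rw [Matrix.coe_units_inv, Matrix.inv_def, Matrix.adjugate_fin_two]
    simpa using ha

/-- `Γ₀(2)` as a subgroup of `PGL(2, ℤ)`. -/
def Gamma0Two : Subgroup PGL(2, ℤ) := gamma0GL.map Matrix.ProjGenLinGroup.mk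

/-- The modular curve `Γ₀(2) \ ℍ`. -/
abbrev ModularCurve : Type := MulAction.orbitRel.Quotient Gamma0Two ℍ

/-- The quotient map `ℍ → Γ₀(2) \ ℍ`. -/
noncomputable def quotientMap (z : ℍ) : ModularCurve :=
  Quotient.mk (MulAction.orbitRel Gamma0Two ℍ) z

/-! ### Infinite geodesics on the modular curve -/

/-- `c` is a lift to `ℍ` of the parametrized curve `γ` on the modular curve, and it is a complete
unit speed geodesic of the hyperbolic plane. -/
def IsGeodesicLift (c : ℝ → ℍ) (γ : ℝ → ModularCurve) : Prop :=
  Isometry c ∧ ∀ t, γ t = quotientMap (c t)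

/-- Infinite geodesics on the modular curve (oriented, parametrized by arc length): the images of
the complete geodesics of `ℍ`. -/
def IsInfiniteGeodesic (γ : ℝ → ModularCurve) : Prop :=
  ∃ c, IsGeodesicLift c γ

/-- Along the filter `l` the curve `c` tends to the boundary point `ξ ∈ P¹(ℝ)`; the limit is taken
in the Riemann sphere. -/
def TendsToBoundary (c : ℝ → ℍ) (l : Filter ℝ) (ξ : OnePoint ℝ) : Prop :=
  Tendsto (fun t => (((c t : ℍ) : ℂ) : OnePoint ℂ)) l
    (𝓝 (OnePoint.map (fun r : ℝ => (r : ℂ)) ξ))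

/-- The set `P¹(ℚ) ⊆ P¹(ℝ)`, whose points become the cusps of the modular curve. -/
def cuspSet : Set (OnePoint ℝ) := Set.range (OnePoint.map (fun q : ℚ => (q : ℝ)))

/-- The geodesic `γ` runs into a cusp at one of its two ends. -/
def EndsAtCusp (γ : ℝ → ModularCurve) : Prop :=
  ∃ c, IsGeodesicLift c γ ∧
    ∃ ξ ∈ cuspSet, TendsToBoundary c atBot ξ ∨ TendsToBoundary c atTop ξ

/-! ### Coding data and the shift -/

/-- The matrix `(-k 1; 1 0)`. -/
def shiftMatrix (k : ℤ) : GL (Fin 2) ℤ where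
  val := !![-k, 1; 1, 0]
  inv := !![0, 1; 1, k]
  val_inv := by ext i j; fin_cases i <;> fin_cases j <;> simp [Matrix.mul_apply, Fin.sum_univ_two]
  inv_val := by ext i j; fin_cases i <;> fin_cases j <;> simp [Matrix.mul_apply, Fin.sum_univ_two]

/-- The class of `(-k 1; 1 0)` in `PGL(2, ℤ)`. -/
def shiftElement (k : ℤ) : PGL(2, ℤ) := Matrix.ProjGenLinGroup.mk (shiftMatrix k)

/-- The generalized Gauss shift `T(x, s) = (1/x - [1/x], (-[1/x] 1; 1 0) • s)`. -/
noncomputable def gaussShift (p : ℝ × P1F2) : ℝ × P1F2 :=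
  (1 / p.1 - ⌊1 / p.1⌋, shiftElement ⌊1 / p.1⌋ • p.2)

/-- A triple `(ω⁻, ω⁺, s)`. -/
@[ext] structure GeodesicData where
  ωm : ℝ
  ωp : ℝ
  s : P1F2

/-- The shift on triples: the generalized Gauss shift on `(ω⁺, s)`, together with
`ω⁻ ↦ 1/ω⁻ - [1/ω⁺]`, which is the image of `ω⁻` under the same matrix. -/
noncomputable def GeodesicData.shift (d : GeodesicData) : GeodesicData where
  ωm := 1 / d.ωm - ⌊1 / d.ωp⌋
  ωp := (gaussShift (d.ωp, d.s)).1
  s := (gaussShift (d.ωp, d.s)).2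

/-- The triples with `ω⁻ ∈ (-∞, -1]` and `ω⁺ ∈ [0, 1]`. -/
def reducedData : Set GeodesicData := {d | d.ωm ≤ -1 ∧ 0 ≤ d.ωp ∧ d.ωp ≤ 1}

/-- The reduced triples whose end points are not cusps. -/
def irrationalData : Set GeodesicData :=
  {d | d ∈ reducedData ∧ Irrational d.ωm ∧ Irrational d.ωp}

/-- The point `∞ = [1 : 0]`, whose stabilizer is `Γ₀(2)`. -/
def pointInfty : P1F2 := Projectivization.mk (ZMod 2) ![1, 0] (by decide)

/-- The reduced triple `(ω⁻, ω⁺, s)` codes the curve `γ`: `γ` is the image of a complete geodesic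
of `ℍ × {s}` from `ω⁻` to `ω⁺` under
`ℍ × P¹(𝔽₂) → PGL(2, ℤ) \ (ℍ × P¹(𝔽₂)) ≅ Γ₀(2) \ ℍ`, which sends `(z, g • ∞)` to the class of
`g⁻¹ • z`. -/
def Codes (d : GeodesicData) (γ : ℝ → ModularCurve) : Prop :=
  d ∈ reducedData ∧
    ∃ c : ℝ → ℍ, Isometry c ∧
      TendsToBoundary c atBot (d.ωm : OnePoint ℝ) ∧ TendsToBoundary c atTop (d.ωp : OnePoint ℝ) ∧
      ∃ g : PGL(2, ℤ), g • pointInfty = d.s ∧ ∀ t, γ t = quotientMap (g⁻¹ • c t)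

/-! ### Mixmaster universes -/

/-- The three space axes. -/
inductive Axis : Type
  | x
  | y
  | z
  deriving DecidableEq

instance : Fintype Axis := ⟨{.x, .y, .z}, by intro a; cases a <;> simp⟩

/-- The labels of the axes: `x ↦ 1 = [1 : 1]`, `y ↦ ∞ = [1 : 0]`, `z ↦ 0 = [0 : 1]`. -/
def axisPoint : Axis → P1F2
  | .x => Projectivization.mk (ZMod 2) ![1, 1] (by decide)
  | .y => pointInfty
  | .z => Projectivization.mk (ZMod 2) ![0, 1] (by decide)

/-- The Kasner exponents `p₁, p₂, p₃` with parameter `u`, attached to `x, y, z` in this order. -/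
noncomputable def kasnerExponent (u : ℝ) : Axis → ℝ
  | .x => -u / (1 + u + u ^ 2)
  | .y => (1 + u) / (1 + u + u ^ 2)
  | .z => u * (1 + u) / (1 + u + u ^ 2)

/-- The state of the universe during one Kasner cycle: the parameter `u`, and the current name
`frame a ∈ {x, y, z}` of each of the three physical directions `a`. The names are permuted in the
course of time so that the direction currently named `x`, `y`, `z` carries `p₁`, `p₂`, `p₃`. -/
@[ext] structure KasnerCycle where
  u : ℝ
  frame : Equiv.Perm Axis

/-- The exponent of the Kasner metric `-dt² + ∑ₐ t ^ (2 pₐ) dxₐ²` of a cycle in the physical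
direction `a`. -/
noncomputable def KasnerCycle.exponent (S : KasnerCycle) (a : Axis) : ℝ := kasnerExponent S.u (S.frame a)

/-- The next cycle inside an era: `u ↦ u - 1` with the permutation `(12)(3)` of the axes. -/
def KasnerCycle.next (S : KasnerCycle) : KasnerCycle where
  u := S.u - 1
  frame := Equiv.swap Axis.x Axis.y * S.frame

/-- The bounce at the end of an era: `u ↦ 1 / u` with the permutation `(1)(23)` of the axes. -/
noncomputable def KasnerCycle.bounce (S : KasnerCycle) : KasnerCycle where
  u := 1 / S.u
  frame := Equiv.swap Axis.y Axis.z * S.frame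

/-- A (discretized) mixmaster universe: Kasner eras indexed by `ℤ`; era `n` begins with a cycle with
parameter `u > 1`, then runs through cycles by steps `u ↦ u - 1`, and when the parameter has fallen
into the range `0 < u < 1`, a bounce starts the era `n + 1`. -/
structure MixmasterUniverse where
  era : ℤ → KasnerCycle
  one_lt_u : ∀ n, 1 < (era n).u
  transition : ∀ n, ∃ k : ℕ, 0 < (KasnerCycle.next^[k] (era n)).u ∧ (KasnerCycle.next^[k] (era n)).u < 1 ∧
    era (n + 1) = (KasnerCycle.next^[k] (era n)).bounce

/-- The two universes are the same up to the choice of the initial era and up to the choice of names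
at the initial time for the physical directions other than the reference direction `a`. -/
def MixmasterUniverse.SameSolution (a : Axis) (U V : MixmasterUniverse) : Prop :=
  ∃ (m : ℤ) (τ : Equiv.Perm Axis), τ a = a ∧
    ∀ n, (V.era n).u = (U.era (n + m)).u ∧ (V.era n).frame = (U.era (n + m)).frame * τ

/-- A two-sided orbit `D` of the shift describes the universe `U`: at the beginning of era `n` the
parameter is `u = 1/ω⁺`, and `s` is the label of the current name of the reference direction `a`. -/
def Describes (D : ℤ → GeodesicData) (a : Axis) (U : MixmasterUniverse) : Prop :=
  ∀ n, (U.era n).u = 1 / (D n).ωp ∧ (D n).s = axisPoint ((U.era n).frame a)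

/-- `D` is a two-sided orbit of the shift through triples that code `γ`. -/
def IsCodingOrbit (D : ℤ → GeodesicData) (γ : ℝ → ModularCurve) : Prop :=
  ∀ n, Codes (D n) γ ∧ D (n + 1) = (D n).shift

/-- The geodesic `γ` determines the universe `U` through a coding orbit. -/
def Determines (γ : ℝ → ModularCurve) (a : Axis) (U : MixmasterUniverse) : Prop :=
  ∃ D, IsCodingOrbit D γ ∧ Describes D a U

end Mixmaster

open Mixmaster

/-!
The proof has a geometric and an arithmetic half.

Every isometry `ℝ → ℍ` is the image of the vertical geodesic `t ↦ i e ^ t` under some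
`M ∈ GL(2, ℝ)` (`exists_eq_gl_smul_verticalGeodesic`): once two of its points are moved to the
imaginary axis, the distances to these two points determine all others. So complete geodesics have
the end points `M • 0 ≠ M • ∞`, on which isometries act by Möbius transformations
(`TendsToBoundary.gl_smul`), a geodesic is determined by two of its points, and by its end points up
to a shift of the parameter. Since `Γ₀(2)` is countable, two lifts `c`, `c'` of the same curve on
the modular curve satisfy `c' t = h • c t` with one and the same `h ∈ Γ₀(2)` for two different times
`t`, hence for all times (`exists_smul_eq_of_lift`). As `Γ₀(2)` is the stabilizer of
`∞ ∈ P¹(𝔽₂)`, the triples that code `γ` are therefore the reduced ones among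
`(A • ξ, A • η, A • ∞)` with `A ∈ PGL(2, ℤ)`, where `ξ`, `η` are the end points of a lift
(`codes_iff`).

It remains to see that the reduced triples in such an orbit of `PGL(2, ℤ)` form exactly one orbit of
the shift. They exist since the Gauss map, applied to `η`, eventually separates it from `ξ`
(`exists_reduced`). If `A` moves one reduced triple to another one, then, up to sign, `A` or `A⁻¹`
has no negative entries (`sign_pattern`), and such a matrix is a product of matrices `(0 1; 1 k)`,
where the `k` are the continued fraction digits (`exists_iterate_shift_of_nonneg`). This is the
two-sided version of Serret's theorem on equivalent irrational numbers.

An era of a mixmaster universe with initial parameter `u` has `⌊u⌋` cycles and permutes the axes by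
`(23)(12) ^ ⌊u⌋`, which is the action of the matrix of the shift on the labels
(`shiftElement_smul_axisPoint`, `MixmasterUniverse.era_succ`). So a two-sided orbit of the shift and
the names of the directions at one time determine the universe.
-/

namespace Mixmaster

/-! ### Complete geodesics of the hyperbolic plane -/

theorem isometry_gl_smul (g : GL (Fin 2) ℝ) : Isometry (fun z : ℍ => g • z) := by
  have hd (z w : ℍ) : dist ((g • z : ℍ) : ℂ) (g • w : ℍ) ^ 2 =
      g.det.val ^ 2 * dist (z : ℂ) w ^ 2 /
        (Complex.normSq (UpperHalfPlane.denom g z) * Complex.normSq (UpperHalfPlane.denom g w)) := by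
    have hz := UpperHalfPlane.denom_ne_zero g z
    have hw := UpperHalfPlane.denom_ne_zero g w
    have h1 : UpperHalfPlane.num g z / UpperHalfPlane.denom g z -
        UpperHalfPlane.num g w / UpperHalfPlane.denom g w =
        (g.det.val : ℂ) * ((z : ℂ) - w) /
          (UpperHalfPlane.denom g z * UpperHalfPlane.denom g w) := by
      rw [div_sub_div _ _ hz hw]
      congr 1
      simp only [UpperHalfPlane.num, UpperHalfPlane.denom,
        Matrix.GeneralLinearGroup.val_det_apply, Matrix.det_fin_two]
      push_cast
      ring
    rw [Complex.dist_eq, UpperHalfPlane.coe_smul, UpperHalfPlane.coe_smul, ← map_sub,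
      UpperHalfPlane.norm_σ, h1, Complex.sq_norm, map_div₀, map_mul, map_mul, Complex.normSq_ofReal,
      ← Complex.sq_norm, ← Complex.dist_eq]
    ring
  refine Isometry.of_dist_eq fun z w => ?_
  have hz := UpperHalfPlane.normSq_denom_pos g z.im_ne_zero
  have hw := UpperHalfPlane.normSq_denom_pos g w.im_ne_zero
  have hg : 0 < |g.det.val| := abs_pos.mpr g.det.ne_zero
  have hzi := z.im_pos
  have hwi := w.im_pos
  refine Real.cosh_injOn dist_nonneg dist_nonneg ?_
  rw [UpperHalfPlane.cosh_dist, UpperHalfPlane.cosh_dist, hd,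
    UpperHalfPlane.im_smul_eq_div_normSq, UpperHalfPlane.im_smul_eq_div_normSq, ← sq_abs g.det.val]
  field_simp

/-- The upward unit speed geodesic `t ↦ i e ^ t` from `0` to `∞`. -/
noncomputable def verticalGeodesic (t : ℝ) : ℍ := ⟨⟨0, Real.exp t⟩, Real.exp_pos t⟩

@[simp] theorem verticalGeodesic_re (t : ℝ) : (verticalGeodesic t).re = 0 := rfl
@[simp] theorem verticalGeodesic_im (t : ℝ) : (verticalGeodesic t).im = Real.exp t := rfl

theorem coe_verticalGeodesic (t : ℝ) :
    ((verticalGeodesic t : ℍ) : ℂ) = (Real.exp t : ℂ) * Complex.I := by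
  apply Complex.ext <;> simp [verticalGeodesic, Complex.exp_ofReal_re, Complex.exp_ofReal_im]

theorem isometry_verticalGeodesic : Isometry verticalGeodesic :=
  UpperHalfPlane.isometry_vertical_line 0

theorem verticalGeodesic_log_im {z : ℍ} (hz : z.re = 0) :
    verticalGeodesic (Real.log z.im) = z := by
  apply UpperHalfPlane.ext_re_im
  · simp [hz]
  · simp [Real.exp_log z.im_pos]

/-- An isometry that agrees with the vertical geodesic at two times is the vertical geodesic: the
distances of `z = c t` to the two given points are linear equations for `‖z‖² / Im z` and
`1 / Im z`. -/
theorem eq_verticalGeodesic_of_isometry {c : ℝ → ℍ} (hc : Isometry c) {t₁ t₂ : ℝ} (h : t₁ ≠ t₂)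
    (h₁ : c t₁ = verticalGeodesic t₁) (h₂ : c t₂ = verticalGeodesic t₂) :
    c = verticalGeodesic := by
  have key (t s : ℝ) (hs : c s = verticalGeodesic s) :
      Real.exp t * ((c t).re ^ 2 + (c t).im ^ 2) + Real.exp t * Real.exp s ^ 2 =
        (c t).im * (Real.exp t ^ 2 + Real.exp s ^ 2) := by
    have h := UpperHalfPlane.cosh_dist' (c t) (c s)
    have hi := (c t).im_pos
    have ht := Real.exp_pos t
    have hs' := Real.exp_pos s
    rw [hc.dist_eq, Real.dist_eq, Real.cosh_abs, hs, Real.cosh_eq, neg_sub, Real.exp_sub,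
      Real.exp_sub] at h
    simp only [verticalGeodesic_re, verticalGeodesic_im, sub_zero] at h
    field_simp at h
    linarith
  funext t
  have e₁ := key t t₁ h₁
  have e₂ := key t t₂ h₂
  have ht := Real.exp_pos t
  have hne : Real.exp t₁ ^ 2 - Real.exp t₂ ^ 2 ≠ 0 := by
    rw [← Real.exp_nat_mul, ← Real.exp_nat_mul, sub_ne_zero, Ne, Real.exp_eq_exp]
    intro h'
    exact h (by simpa using h')
  have him : (c t).im = Real.exp t := by
    have : (Real.exp t - (c t).im) * (Real.exp t₁ ^ 2 - Real.exp t₂ ^ 2) = 0 := by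
      linear_combination e₁ - e₂
    rcases mul_eq_zero.1 this with h' | h'
    · linarith
    · exact absurd h' hne
  have hre : (c t).re = 0 := by
    rw [him] at e₁
    have : Real.exp t * (c t).re ^ 2 = 0 := by linear_combination e₁
    simpa [ht.ne'] using this
  exact UpperHalfPlane.ext_re_im (by simp [hre]) (by simp [him])

/-- The diagonal matrix `(exp p 0; 0 1)`. -/
noncomputable def scaling (p : ℝ) : GL (Fin 2) ℝ :=
  .mkOfDetNeZero !![Real.exp p, 0; 0, 1] (by simp)

theorem scaling_smul (p t : ℝ) : scaling p • verticalGeodesic t = verticalGeodesic (p + t) := by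
  apply UpperHalfPlane.ext
  rw [UpperHalfPlane.coe_smul_of_det_pos (by simp [scaling, Real.exp_pos]), coe_verticalGeodesic,
    coe_verticalGeodesic]
  simp [scaling, UpperHalfPlane.num, UpperHalfPlane.denom, Complex.exp_add, mul_assoc]

/-- The antidiagonal matrix `(0 1; 1 0)`, which reverses the vertical geodesic. -/
noncomputable def flipping : GL (Fin 2) ℝ := .mkOfDetNeZero !![0, 1; 1, 0] (by simp)

theorem flipping_smul (t : ℝ) : flipping • verticalGeodesic t = verticalGeodesic (-t) := by
  have ht := Real.exp_pos t
  have h : UpperHalfPlane.denom flipping (verticalGeodesic t : ℂ) = Real.exp t * Complex.I := by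
    rw [coe_verticalGeodesic]; simp [flipping, UpperHalfPlane.denom]
  have h' : UpperHalfPlane.num flipping (verticalGeodesic t : ℂ) = 1 := by
    simp [flipping, UpperHalfPlane.num]
  apply UpperHalfPlane.ext_re_im
  · rw [UpperHalfPlane.re_smul, h, h']
    simp
  · rw [UpperHalfPlane.im_smul_eq_div_normSq, h]
    rw [map_mul, Complex.normSq_ofReal]
    simp [flipping, Real.exp_neg]

/-- Any two points of `ℍ` can be moved to the imaginary axis: the end points of the geodesic through
them are sent to `0` and `∞`. -/
theorem exists_gl_smul_re_eq_zero (z w : ℍ) :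
    ∃ g : GL (Fin 2) ℝ, (g • z).re = 0 ∧ (g • w).re = 0 := by
  by_cases h : z.re = w.re
  · refine ⟨.mkOfDetNeZero !![1, -z.re; 0, 1] (by simp), ?_, ?_⟩ <;>
    rw [UpperHalfPlane.re_smul] <;> simp [UpperHalfPlane.num, UpperHalfPlane.denom, h]
  · -- `z` and `w` lie on the half circle with centre `m` and radius `r`.
    set m : ℝ := (w.re ^ 2 + w.im ^ 2 - z.re ^ 2 - z.im ^ 2) / (2 * (w.re - z.re)) with hm
    set r : ℝ := √((z.re - m) ^ 2 + z.im ^ 2) with hr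
    have hz := z.im_pos
    have hr2 : r ^ 2 = (z.re - m) ^ 2 + z.im ^ 2 := Real.sq_sqrt (by positivity)
    have hr0 : 0 < r := Real.sqrt_pos.2 (by positivity)
    have hw2 : r ^ 2 = (w.re - m) ^ 2 + w.im ^ 2 := by
      have : w.re - z.re ≠ 0 := sub_ne_zero.2 (Ne.symm h)
      have hm' : m * (2 * (w.re - z.re)) = w.re ^ 2 + w.im ^ 2 - z.re ^ 2 - z.im ^ 2 := by
        rw [hm]; field_simp
      rw [hr2]; linear_combination hm'
    refine ⟨.mkOfDetNeZero !![1, r - m; -1, m + r] ?_, ?_, ?_⟩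
    · rw [Matrix.det_fin_two]; simp; linarith
    all_goals
      rw [UpperHalfPlane.re_smul, Complex.div_re, ← add_div, div_eq_zero_iff]
      left
      simp [UpperHalfPlane.num, UpperHalfPlane.denom]
    · linear_combination hr2
    · linear_combination hw2

/-- Every complete unit speed geodesic is a translate of the vertical one. -/
theorem exists_eq_gl_smul_verticalGeodesic {c : ℝ → ℍ} (hc : Isometry c) :
    ∃ g : GL (Fin 2) ℝ, ∀ t, c t = g • verticalGeodesic t := by
  suffices h : ∃ g : GL (Fin 2) ℝ, ∃ p, g • c 0 = verticalGeodesic p ∧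
      g • c 1 = verticalGeodesic (p + 1) by
    obtain ⟨g, p, h0, h1⟩ := h
    have := eq_verticalGeodesic_of_isometry (c := fun t => (scaling p)⁻¹ • g • c t)
      ((isometry_gl_smul _).comp ((isometry_gl_smul g).comp hc)) zero_ne_one
      (by simp only [h0]; rw [inv_smul_eq_iff, scaling_smul, add_zero])
      (by simp only [h1]; rw [inv_smul_eq_iff, scaling_smul])
    refine ⟨g⁻¹ * scaling p, fun t => ?_⟩
    rw [← congrFun this t, mul_smul, smul_inv_smul, inv_smul_smul]
  obtain ⟨g, h0, h1⟩ := exists_gl_smul_re_eq_zero (c 0) (c 1)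
  set p := Real.log (g • c 0).im
  set q := Real.log (g • c 1).im
  have e0 : g • c 0 = verticalGeodesic p := (verticalGeodesic_log_im h0).symm
  have e1 : g • c 1 = verticalGeodesic q := (verticalGeodesic_log_im h1).symm
  have hd : dist p q = 1 := by
    rw [← isometry_verticalGeodesic.dist_eq, ← e0, ← e1, (isometry_gl_smul g).dist_eq, hc.dist_eq]
    simp
  rw [Real.dist_eq] at hd
  rcases (abs_eq zero_le_one).1 hd with hd | hd
  · refine ⟨flipping * g, -p, ?_, ?_⟩
    · rw [mul_smul, e0, flipping_smul]
    · rw [mul_smul, e1, flipping_smul]; congr 1; linarith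
  · exact ⟨g, p, e0, by rw [e1]; congr 1; linarith⟩

theorem isometry_eq_of_eq_at_two {c c' : ℝ → ℍ} (hc : Isometry c) (hc' : Isometry c') {t₁ t₂ : ℝ}
    (h : t₁ ≠ t₂) (h₁ : c' t₁ = c t₁) (h₂ : c' t₂ = c t₂) : c' = c := by
  obtain ⟨g, hg⟩ := exists_eq_gl_smul_verticalGeodesic hc
  have := eq_verticalGeodesic_of_isometry (c := fun t => g⁻¹ • c' t)
      ((isometry_gl_smul _).comp hc') h
      (by simp only [h₁, hg, inv_smul_smul]) (by simp only [h₂, hg, inv_smul_smul])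
  funext t
  rw [hg, ← congrFun this t, smul_inv_smul]

/-- A Möbius transformation with real coefficients is continuous at `∞` on the Riemann sphere. -/
theorem tendsto_moebius_infty {a b c d : ℝ} (h : a * d - b * c ≠ 0) {α : Type*} {l : Filter α}
    {f : α → ℂ} (hf : Tendsto f l (Bornology.cobounded ℂ)) :
    Tendsto (fun t => (((a * f t + b) / (c * f t + d) : ℂ) : OnePoint ℂ)) l
      (𝓝 (OnePoint.map (fun r : ℝ => (r : ℂ))
        (if c = 0 then OnePoint.infty else ((a / c : ℝ) : OnePoint ℝ)))) := by
  by_cases hc : c = 0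
  · subst hc
    have had : a ≠ 0 ∧ d ≠ 0 := by constructor <;> rintro rfl <;> simp at h
    rw [if_pos rfl]
    have hda : (a / d : ℂ) ≠ 0 := by simp [had]
    have h1 : Tendsto (fun t => (a / d : ℂ) * f t + b / d) l (Bornology.cobounded ℂ) :=
      (tendsto_add_const_cobounded (b / d : ℂ)).comp ((tendsto_mul_left_cobounded hda).comp hf)
    rw [Metric.cobounded_eq_cocompact, ← coclosedCompact_eq_cocompact] at h1
    refine (OnePoint.tendsto_coe_infty.comp h1).congr fun t => ?_
    have : (d : ℂ) ≠ 0 := by simp [had]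
    simp only [Function.comp]
    congr 1
    rw [Complex.ofReal_zero, zero_mul, zero_add]
    field_simp
  · have hc' : (c : ℂ) ≠ 0 := by simp [hc]
    rw [if_neg hc]
    refine (OnePoint.continuous_coe.tendsto _).comp ?_
    have hi := Filter.tendsto_inv₀_cobounded.comp hf
    have h1 : Tendsto (fun t => (a + b * (f t)⁻¹ : ℂ) / (c + d * (f t)⁻¹)) l (𝓝 ((a / c : ℝ) : ℂ)) := by
      have := ((tendsto_const_nhds (x := (a : ℂ))).add (hi.const_mul (b : ℂ))).div
        ((tendsto_const_nhds (x := (c : ℂ))).add (hi.const_mul (d : ℂ))) (by simp [hc])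
      simpa [Function.comp_def, Pi.div_def] using this
    refine h1.congr' ?_
    filter_upwards [hf.eventually (Bornology.eventually_ne_cobounded 0)] with t ht
    field_simp

open OnePoint in
/-- The geodesic `t ↦ g • i e ^ t` runs from `g • 0` to `g • ∞`. -/
theorem tendsToBoundary_gl_smul (g : GL (Fin 2) ℝ) :
    TendsToBoundary (fun t => g • verticalGeodesic t) atTop (g • ∞) ∧
    TendsToBoundary (fun t => g • verticalGeodesic t) atBot (g • ((0 : ℝ) : OnePoint ℝ)) := by
  -- A matrix of negative determinant acts with a complex conjugation, which replaces `i` by `-i`.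
  obtain ⟨e, he, hσ⟩ : ∃ e : ℂ, ‖e‖ = 1 ∧ ∀ t : ℝ,
      UpperHalfPlane.σ g (verticalGeodesic t) = Real.exp t * e := by
    by_cases h : 0 < g.det.val
    · refine ⟨Complex.I, by simp, fun t => ?_⟩
      rw [UpperHalfPlane.σ, if_pos h, coe_verticalGeodesic, ContinuousAlgEquiv.refl_apply]
    · refine ⟨-Complex.I, by simp, fun t => ?_⟩
      rw [UpperHalfPlane.σ, if_neg h, coe_verticalGeodesic, Complex.conjCAE_apply, map_mul,
        Complex.conj_ofReal, Complex.conj_I]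
  have he0 : e ≠ 0 := by intro h; simp [h] at he
  have hcoe (t : ℝ) : ((g • verticalGeodesic t : ℍ) : ℂ) =
      (g 0 0 * (Real.exp t * e) + g 0 1) / (g 1 0 * (Real.exp t * e) + g 1 1) := by
    rw [UpperHalfPlane.coe_smul, map_div₀, UpperHalfPlane.σ_num, UpperHalfPlane.σ_denom, hσ]
    rfl
  have hdet : g 0 0 * g 1 1 - g 0 1 * g 1 0 ≠ 0 := by
    rw [← Matrix.det_fin_two]; exact g.det_ne_zero
  constructor
  · have hf : Tendsto (fun t : ℝ => (Real.exp t * e : ℂ)) atTop (Bornology.cobounded ℂ) := by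
      rw [← tendsto_norm_atTop_iff_cobounded]
      simpa [he, Complex.norm_exp] using Real.tendsto_exp_atTop
    have := tendsto_moebius_infty hdet hf
    rw [← OnePoint.smul_infty_eq_ite] at this
    exact this.congr fun t => by rw [hcoe]
  · have hf : Tendsto (fun t : ℝ => ((Real.exp t * e)⁻¹ : ℂ)) atBot (Bornology.cobounded ℂ) := by
      rw [← tendsto_norm_atTop_iff_cobounded]
      have := Real.tendsto_exp_atTop.comp tendsto_neg_atBot_atTop
      simpa [he, Complex.norm_exp, Function.comp_def, Real.exp_neg] using this
    have hdet' : g 0 1 * g 1 0 - g 0 0 * g 1 1 ≠ 0 := by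
      intro h; apply hdet; linarith
    have := tendsto_moebius_infty hdet' hf
    have h0 : g • ((0 : ℝ) : OnePoint ℝ) =
        if g 1 1 = 0 then ∞ else ((g 0 1 / g 1 1 : ℝ) : OnePoint ℝ) := by
      simp [OnePoint.smul_some_eq_ite]
    rw [← h0] at this
    -- Continuity at `0` is continuity at `∞` after the substitution `z ↦ z⁻¹`.
    refine this.congr fun t => ?_
    have ht : (Real.exp t * e : ℂ) ≠ 0 := mul_ne_zero (by simp) he0
    rw [hcoe]
    congr 1
    rw [← mul_div_mul_left _ _ ht]
    congr 1 <;> field_simp <;> ring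

theorem tendsToBoundary_unique {c : ℝ → ℍ} {l : Filter ℝ} [l.NeBot] {ξ η : OnePoint ℝ}
    (hξ : TendsToBoundary c l ξ) (hη : TendsToBoundary c l η) : ξ = η :=
  Option.map_injective Complex.ofReal_injective
    (tendsto_nhds_unique (X := OnePoint ℂ) hξ hη)

/-- Complete geodesics have end points, and `GL(2, ℝ)` moves them by Möbius transformations. -/
theorem TendsToBoundary.gl_smul {c : ℝ → ℍ} (hc : Isometry c) {ξ η : OnePoint ℝ}
    (hξ : TendsToBoundary c atBot ξ) (hη : TendsToBoundary c atTop η) (g : GL (Fin 2) ℝ) :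
    TendsToBoundary (fun t => g • c t) atBot (g • ξ) ∧
      TendsToBoundary (fun t => g • c t) atTop (g • η) := by
  obtain ⟨M, hM⟩ := exists_eq_gl_smul_verticalGeodesic hc
  obtain rfl : c = fun t => M • verticalGeodesic t := funext hM
  have h := tendsToBoundary_gl_smul M
  have h' := tendsToBoundary_gl_smul (g * M)
  rw [tendsToBoundary_unique hξ h.2, tendsToBoundary_unique hη h.1]
  simp only [mul_smul] at h'
  exact ⟨h'.2, h'.1⟩

theorem exists_endpoints {c : ℝ → ℍ} (hc : Isometry c) :
    ∃ ξ η : OnePoint ℝ, ξ ≠ η ∧ TendsToBoundary c atBot ξ ∧ TendsToBoundary c atTop η := by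
  obtain ⟨M, hM⟩ := exists_eq_gl_smul_verticalGeodesic hc
  obtain rfl : c = fun t => M • verticalGeodesic t := funext hM
  have h := tendsToBoundary_gl_smul M
  refine ⟨_, _, ?_, h.2, h.1⟩
  simp

theorem exists_geodesic {x y : ℝ} (h : y ≠ x) :
    ∃ c : ℝ → ℍ, Isometry c ∧ TendsToBoundary c atBot (y : OnePoint ℝ) ∧
      TendsToBoundary c atTop (x : OnePoint ℝ) := by
  set M : GL (Fin 2) ℝ := .mkOfDetNeZero !![x, y; 1, 1] (by simpa [sub_eq_zero] using h.symm) with hM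
  have h := tendsToBoundary_gl_smul M
  have e1 : M • (OnePoint.infty : OnePoint ℝ) = x := by
    rw [OnePoint.smul_infty_eq_ite]; simp [hM]
  have e2 : M • ((0 : ℝ) : OnePoint ℝ) = y := by
    rw [OnePoint.smul_some_eq_ite]; simp [hM]
  rw [e1, e2] at h
  exact ⟨_, (isometry_gl_smul M).comp isometry_verticalGeodesic, h.2, h.1⟩

/-- Complete geodesics with the same end points differ by a shift of the parameter. -/
theorem exists_eq_comp_add {c c' : ℝ → ℍ} (hc : Isometry c) (hc' : Isometry c') {ξ η : OnePoint ℝ}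
    (hξ : TendsToBoundary c atBot ξ) (hη : TendsToBoundary c atTop η)
    (hξ' : TendsToBoundary c' atBot ξ) (hη' : TendsToBoundary c' atTop η) :
    ∃ t₀, ∀ t, c' t = c (t + t₀) := by
  obtain ⟨M, hM⟩ := exists_eq_gl_smul_verticalGeodesic hc
  obtain ⟨N, hN⟩ := exists_eq_gl_smul_verticalGeodesic (c := fun t => M⁻¹ • c' t)
    ((isometry_gl_smul _).comp hc')
  have h1 := TendsToBoundary.gl_smul hc hξ hη M⁻¹
  have h2 := TendsToBoundary.gl_smul hc' hξ' hη' M⁻¹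
  have hv := tendsToBoundary_gl_smul 1
  have hn := tendsToBoundary_gl_smul N
  simp only [hM, inv_smul_smul] at h1
  simp only [hN] at h2
  simp only [one_smul] at hv
  have e1 := tendsToBoundary_unique h2.1 hn.2
  have e2 := tendsToBoundary_unique h2.2 hn.1
  rw [tendsToBoundary_unique h1.1 hv.2] at e1
  rw [tendsToBoundary_unique h1.2 hv.1] at e2
  have n10 : N 1 0 = 0 := OnePoint.smul_infty_eq_self_iff.1 e2.symm
  have hdet : N 0 0 * N 1 1 - N 0 1 * N 1 0 ≠ 0 := by
    rw [← Matrix.det_fin_two]; exact N.det_ne_zero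
  have n11 : N 1 1 ≠ 0 := by intro h; simp [n10, h] at hdet
  have n00 : N 0 0 ≠ 0 := by intro h; simp [n10, h] at hdet
  have n01 : N 0 1 = 0 := by
    rw [OnePoint.smul_some_eq_ite] at e1
    simpa [n11, eq_comm (a := (0 : ℝ))] using e1
  refine ⟨Real.log |N 0 0 / N 1 1|, fun t => ?_⟩
  have key : N • verticalGeodesic t = verticalGeodesic (t + Real.log |N 0 0 / N 1 1|) := by
    have hpos : 0 < |N 0 0 / N 1 1| := abs_pos.2 (div_ne_zero n00 n11)
    apply UpperHalfPlane.ext_re_im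
    · rw [UpperHalfPlane.re_smul]
      simp [UpperHalfPlane.num, UpperHalfPlane.denom, n10, n01, coe_verticalGeodesic,
        Complex.div_re, -Complex.ofReal_exp]
    · rw [UpperHalfPlane.im_smul_eq_div_normSq, verticalGeodesic_im, verticalGeodesic_im,
        Real.exp_add, Real.exp_log hpos]
      simp only [UpperHalfPlane.denom, n10, Matrix.GeneralLinearGroup.val_det_apply,
        Matrix.det_fin_two, n01]
      have h11 := abs_pos.2 n11
      simp only [Complex.ofReal_zero, zero_mul, zero_add, mul_zero, sub_zero, abs_mul, abs_div,
        Complex.normSq_ofReal, ← abs_mul_abs_self (N 1 1 : ℝ)]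
      field_simp
  rw [hM, ← key, ← hN, smul_inv_smul]

/-! ### The actions of `PGL(2, ℤ)` -/

/-- An integral matrix, viewed as a real one. -/
def realMatrix : GL (Fin 2) ℤ →* GL (Fin 2) ℝ :=
  Matrix.GeneralLinearGroup.map (Int.castRingHom ℝ)

@[simp] theorem realMatrix_apply (A : GL (Fin 2) ℤ) (i j : Fin 2) :
    realMatrix A i j = (A i j : ℝ) := rfl

theorem isometry_pgl_smul (g : PGL(2, ℤ)) : Isometry (fun z : ℍ => g • z) := by
  induction g using Matrix.ProjGenLinGroup.induction_on with
  | mk A => exact isometry_gl_smul (realMatrix A)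

theorem countable_pgl : Countable PGL(2, ℤ) := by
  have : Countable (Matrix (Fin 2) (Fin 2) ℤ) := inferInstanceAs (Countable (Fin 2 → Fin 2 → ℤ))
  have : Countable (GL (Fin 2) ℤ) := Units.val_injective.countable
  exact Matrix.ProjGenLinGroup.mk_surjective.countable

theorem det_eq_one_or_neg_one (A : GL (Fin 2) ℤ) :
    A 0 0 * A 1 1 - A 0 1 * A 1 0 = 1 ∨ A 0 0 * A 1 1 - A 0 1 * A 1 0 = -1 := by
  rw [← Matrix.det_fin_two]
  exact Int.isUnit_iff.1 A.det.isUnit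

/-- A point of the projective line over `𝔽₂` has only one representative, as `1` is the only unit. -/
theorem mk_P1F2_eq_iff {v w : Fin 2 → ZMod 2} (hv : v ≠ 0) (hw : w ≠ 0) :
    Projectivization.mk (ZMod 2) v hv = Projectivization.mk (ZMod 2) w hw ↔ v = w := by
  rw [Projectivization.mk_eq_mk_iff']
  constructor
  · rintro ⟨a, rfl⟩
    have : ∀ a : ZMod 2, a = 0 ∨ a = 1 := by decide
    rcases this a with rfl | rfl
    · simp at hv
    · simp
  · rintro rfl
    exact ⟨1, one_smul _ _⟩

theorem mk_smul_P1F2_eq_iff (A : GL (Fin 2) ℤ) {v w : Fin 2 → ZMod 2} (hv : v ≠ 0) (hw : w ≠ 0) :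
    Matrix.ProjGenLinGroup.mk A • (Projectivization.mk (ZMod 2) v hv : P1F2) =
        Projectivization.mk (ZMod 2) w hw ↔
      ((A 0 0 : ZMod 2) * v 0 + (A 0 1 : ZMod 2) * v 1 = w 0 ∧
        (A 1 0 : ZMod 2) * v 0 + (A 1 1 : ZMod 2) * v 1 = w 1) := by
  change Matrix.GeneralLinearGroup.map (Int.castRingHom (ZMod 2)) A •
    (Projectivization.mk (ZMod 2) v hv : P1F2) = _ ↔ _
  rw [Projectivization.smul_mk, mk_P1F2_eq_iff, Matrix.GeneralLinearGroup.fin_two_smul,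
    funext_iff, Fin.forall_fin_two]
  simp

theorem axisPoint_bijective : Function.Bijective axisPoint := by
  constructor
  · intro a b h
    cases a <;> cases b <;> first
      | rfl
      | (exfalso
         simp only [axisPoint, pointInfty, mk_P1F2_eq_iff] at h
         revert h
         decide)
  · intro s
    induction s using Projectivization.ind with
    | h v hv =>
      have h2 : ∀ v : Fin 2 → ZMod 2, v ≠ 0 → v = ![1, 1] ∨ v = ![1, 0] ∨ v = ![0, 1] := by decide
      rcases h2 v hv with rfl | rfl | rfl
      exacts [⟨.x, rfl⟩, ⟨.y, rfl⟩, ⟨.z, rfl⟩]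

@[simp] theorem shiftMatrix_zero_zero (k : ℤ) : shiftMatrix k 0 0 = -k := rfl
@[simp] theorem shiftMatrix_zero_one (k : ℤ) : shiftMatrix k 0 1 = 1 := rfl
@[simp] theorem shiftMatrix_one_zero (k : ℤ) : shiftMatrix k 1 0 = 1 := rfl
@[simp] theorem shiftMatrix_one_one (k : ℤ) : shiftMatrix k 1 1 = 0 := rfl

theorem shiftElement_smul_of_even {k : ℤ} (hk : Even k) (b : Axis) :
    shiftElement k • axisPoint b = axisPoint (Equiv.swap Axis.y Axis.z b) := by
  have hk' : (k : ZMod 2) = 0 := (ZMod.intCast_zmod_eq_zero_iff_dvd k 2).2 hk.two_dvd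
  cases b
  · rw [Equiv.swap_apply_of_ne_of_ne (by decide) (by decide)]
    refine (mk_smul_P1F2_eq_iff _ _ _).2 ?_
    simp [hk']
  · rw [Equiv.swap_apply_left]
    refine (mk_smul_P1F2_eq_iff _ _ _).2 ?_
    simp [hk']
  · rw [Equiv.swap_apply_right]
    refine (mk_smul_P1F2_eq_iff _ _ _).2 ?_
    simp

theorem shiftElement_smul_of_odd {k : ℤ} (hk : Odd k) (b : Axis) :
    shiftElement k • axisPoint b =
      axisPoint ((Equiv.swap Axis.y Axis.z * Equiv.swap Axis.x Axis.y) b) := by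
  have hk' : (k : ZMod 2) = 1 := (ZMod.intCast_eq_one_iff_odd (n := k)).2 hk
  have h11 : (1 + 1 : ZMod 2) = 0 := by decide
  cases b
  · rw [show (Equiv.swap Axis.y Axis.z * Equiv.swap Axis.x Axis.y) Axis.x = Axis.z from by decide]
    refine (mk_smul_P1F2_eq_iff _ _ _).2 ?_
    simp [hk', h11]
  · rw [show (Equiv.swap Axis.y Axis.z * Equiv.swap Axis.x Axis.y) Axis.y = Axis.x from by decide]
    refine (mk_smul_P1F2_eq_iff _ _ _).2 ?_
    simp [hk']
  · rw [show (Equiv.swap Axis.y Axis.z * Equiv.swap Axis.x Axis.y) Axis.z = Axis.y from by decide]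
    refine (mk_smul_P1F2_eq_iff _ _ _).2 ?_
    simp

theorem exists_smul_pointInfty (s : P1F2) : ∃ g : PGL(2, ℤ), g • pointInfty = s := by
  obtain ⟨b, rfl⟩ := axisPoint_bijective.2 s
  cases b
  · exact ⟨shiftElement 1, shiftElement_smul_of_odd odd_one .y⟩
  · exact ⟨1, one_smul _ _⟩
  · have h := shiftElement_smul_of_even Even.zero .y
    rw [Equiv.swap_apply_left] at h
    exact ⟨shiftElement 0, h⟩

/-- `Γ₀(2)` is the stabilizer of `∞ ∈ P¹(𝔽₂)`. -/
theorem mem_Gamma0Two_iff (g : PGL(2, ℤ)) : g ∈ Gamma0Two ↔ g • pointInfty = pointInfty := by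
  have key (A : GL (Fin 2) ℤ) :
      Matrix.ProjGenLinGroup.mk A • pointInfty = pointInfty ↔ (2 : ℤ) ∣ A 1 0 := by
    rw [pointInfty, mk_smul_P1F2_eq_iff]
    simp only [Matrix.cons_val_zero, Matrix.cons_val_one, mul_one, mul_zero, add_zero]
    rw [ZMod.intCast_zmod_eq_zero_iff_dvd]
    refine ⟨fun h => by exact_mod_cast h.2, fun h => ⟨?_, by exact_mod_cast h⟩⟩
    rw [ZMod.intCast_eq_one_iff_odd]
    by_contra hA
    rw [Int.not_odd_iff_even] at hA
    have h1 : (2 : ℤ) ∣ A 0 0 * A 1 1 - A 0 1 * A 1 0 :=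
      dvd_sub (hA.two_dvd.mul_right _) (h.mul_left _)
    rcases det_eq_one_or_neg_one A with h' | h' <;> rw [h'] at h1 <;> omega
  constructor
  · rintro ⟨A, hA, rfl⟩
    exact (key A).2 hA
  · induction g using Matrix.ProjGenLinGroup.induction_on with
    | mk A => exact fun h => ⟨A, (key A).1 h, rfl⟩

theorem quotientMap_eq_iff {z w : ℍ} :
    quotientMap z = quotientMap w ↔ ∃ g ∈ Gamma0Two, g • w = z := by
  rw [quotientMap, quotientMap, Quotient.eq, MulAction.orbitRel_apply]
  constructor
  · rintro ⟨⟨g, hg⟩, h⟩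
    exact ⟨g, hg, h⟩
  · rintro ⟨g, hg, h⟩
    exact ⟨⟨g, hg⟩, h⟩

/-! ### The action on the boundary -/

theorem denom_ne_zero_of_irrational (A : GL (Fin 2) ℤ) {x : ℝ} (hx : Irrational x) :
    (A 1 0 : ℝ) * x + A 1 1 ≠ 0 := by
  intro h
  by_cases hc : A 1 0 = 0
  · have hd : A 1 1 = 0 := by simpa [hc] using h
    rcases det_eq_one_or_neg_one A with h' | h' <;> simp [hc, hd] at h'
  · exact ((hx.intCast_mul hc).add_intCast (A 1 1)).ne_zero h

theorem realMatrix_smul_coe (A : GL (Fin 2) ℤ) {x : ℝ} (hx : Irrational x) :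
    realMatrix A • (x : OnePoint ℝ) =
      (((A 0 0 * x + A 0 1) / (A 1 0 * x + A 1 1) : ℝ) : OnePoint ℝ) := by
  rw [OnePoint.smul_some_eq_ite]
  simp [denom_ne_zero_of_irrational A hx]

theorem realMatrix_smul_coe_eq_iff (A : GL (Fin 2) ℤ) {x y : ℝ} (hx : Irrational x) :
    realMatrix A • (x : OnePoint ℝ) = y ↔ A 0 0 * x + A 0 1 = y * (A 1 0 * x + A 1 1) := by
  rw [realMatrix_smul_coe A hx, OnePoint.coe_eq_coe, div_eq_iff (denom_ne_zero_of_irrational A hx)]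

theorem coe_mem_cuspSet_iff (x : ℝ) : (x : OnePoint ℝ) ∈ cuspSet ↔ ¬ Irrational x := by
  rw [Irrational, not_not]
  constructor
  · rintro ⟨q, hq⟩
    cases q with
    | infty => simp at hq
    | coe q => exact ⟨q, by simpa using hq⟩
  · rintro ⟨q, rfl⟩
    exact ⟨q, rfl⟩

theorem smul_mem_cuspSet (A : GL (Fin 2) ℤ) {ξ : OnePoint ℝ} (h : ξ ∈ cuspSet) :
    realMatrix A • ξ ∈ cuspSet := by
  obtain ⟨q, rfl⟩ := h
  refine ⟨Matrix.GeneralLinearGroup.map (Int.castRingHom ℚ) A • q, ?_⟩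
  have := OnePoint.map_smul (Rat.castHom ℝ) (Matrix.GeneralLinearGroup.map (Int.castRingHom ℚ) A) q
  refine this.trans ?_
  congr 1

theorem smul_mem_cuspSet_iff (A : GL (Fin 2) ℤ) {ξ : OnePoint ℝ} :
    realMatrix A • ξ ∈ cuspSet ↔ ξ ∈ cuspSet := by
  refine ⟨fun h => ?_, smul_mem_cuspSet A⟩
  have := smul_mem_cuspSet A⁻¹ h
  rwa [map_inv, inv_smul_smul] at this

theorem infty_mem_cuspSet : (OnePoint.infty : OnePoint ℝ) ∈ cuspSet := ⟨OnePoint.infty, rfl⟩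

theorem exists_irrational_of_notMem_cuspSet {ξ : OnePoint ℝ} (h : ξ ∉ cuspSet) :
    ∃ x : ℝ, Irrational x ∧ ξ = x := by
  cases ξ with
  | infty => exact absurd infty_mem_cuspSet h
  | coe x => exact ⟨x, by rwa [coe_mem_cuspSet_iff, not_not] at h, rfl⟩

/-! ### The shift on reduced triples -/

theorem mem_irrationalData_iff {d : GeodesicData} : d ∈ irrationalData ↔
    d.ωm < -1 ∧ 0 < d.ωp ∧ d.ωp < 1 ∧ Irrational d.ωm ∧ Irrational d.ωp := by
  constructor
  · rintro ⟨⟨h1, h2, h3⟩, hm, hp⟩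
    refine ⟨lt_of_le_of_ne h1 ?_, lt_of_le_of_ne h2 hp.ne_zero.symm, lt_of_le_of_ne h3 hp.ne_one,
      hm, hp⟩
    exact_mod_cast hm.ne_int (-1)
  · rintro ⟨h1, h2, h3, hm, hp⟩
    exact ⟨⟨h1.le, h2.le, h3.le⟩, hm, hp⟩

theorem irrational_one_div_sub {x : ℝ} (hx : Irrational x) (k : ℤ) : Irrational (1 / x - k) := by
  rw [one_div]
  exact hx.inv.sub_intCast k

theorem one_le_floor {x : ℝ} (h0 : 0 < x) (h1 : x < 1) : 1 ≤ ⌊1 / x⌋ := by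
  rw [Int.le_floor]
  push_cast
  exact (one_le_div h0).2 h1.le

theorem gauss_mem_Ioo {x : ℝ} (hx : Irrational x) :
    0 < 1 / x - ⌊1 / x⌋ ∧ 1 / x - ⌊1 / x⌋ < 1 := by
  have h := (irrational_one_div_sub hx ⌊1 / x⌋).ne_zero
  exact ⟨lt_of_le_of_ne (Int.fract_nonneg _) h.symm, Int.fract_lt_one _⟩

theorem neg_one_lt_one_div {y : ℝ} (h : y < -1) : -1 < 1 / y ∧ 1 / y < 0 := by
  have hy : y < 0 := by linarith
  exact ⟨by rw [lt_div_iff_of_neg hy]; linarith, one_div_neg.2 hy⟩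

theorem shift_mem {d : GeodesicData} (hd : d ∈ irrationalData) : d.shift ∈ irrationalData := by
  rw [mem_irrationalData_iff] at *
  obtain ⟨h1, h2, h3, hm, hp⟩ := hd
  have hk : (1 : ℝ) ≤ ⌊1 / d.ωp⌋ := by exact_mod_cast one_le_floor h2 h3
  have hy := neg_one_lt_one_div h1
  exact ⟨by simp only [GeodesicData.shift]; linarith, (gauss_mem_Ioo hp).1, (gauss_mem_Ioo hp).2,
    irrational_one_div_sub hm _, irrational_one_div_sub hp _⟩

/-- The digit removed by the shift can be read off from the new `ω⁻`. -/
theorem floor_neg_shift {d : GeodesicData} (hd : d ∈ irrationalData) :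
    ⌊-d.shift.ωm⌋ = ⌊1 / d.ωp⌋ := by
  have hy := neg_one_lt_one_div (mem_irrationalData_iff.1 hd).1
  rw [Int.floor_eq_iff]
  simp only [GeodesicData.shift]
  constructor <;> linarith

theorem shift_bijOn : Set.BijOn GeodesicData.shift irrationalData irrationalData := by
  refine ⟨fun d hd => shift_mem hd, ?_, ?_⟩
  · intro d hd e he h
    have hk := floor_neg_shift hd
    rw [h, floor_neg_shift he] at hk
    simp only [GeodesicData.shift, gaussShift, GeodesicData.mk.injEq] at h
    rw [hk] at h
    obtain ⟨h1, h2, h3⟩ := h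
    ext1
    · simpa using h1
    · rwa [sub_left_inj, one_div, one_div, inv_inj] at h2
    · exact MulAction.injective _ h3
  · intro e he
    obtain ⟨h1, h2, h3, hm, hp⟩ := mem_irrationalData_iff.1 he
    set k := ⌊-e.ωm⌋ with hk
    have hk1 : (1 : ℝ) ≤ k := by
      exact_mod_cast Int.le_floor.2 (by push_cast; linarith)
    have hf : (k : ℝ) < -e.ωm := lt_of_le_of_ne (Int.floor_le _) (hm.neg.ne_int _).symm
    have hf' : -e.ωm < k + 1 := Int.lt_floor_add_one _
    have hfl : ⌊1 / (1 / (e.ωp + k))⌋ = k := by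
      rw [one_div_one_div, Int.floor_eq_iff]; constructor <;> linarith
    refine ⟨⟨1 / (e.ωm + k), 1 / (e.ωp + k), (shiftElement k)⁻¹ • e.s⟩, ?_, ?_⟩
    · rw [mem_irrationalData_iff]
      refine ⟨?_, ?_, ?_, ?_, ?_⟩
      · change 1 / (e.ωm + k) < -1
        rw [div_lt_iff_of_neg (by linarith)]; linarith
      · change 0 < 1 / (e.ωp + k)
        exact one_div_pos.2 (by linarith)
      · change 1 / (e.ωp + k) < 1
        rw [div_lt_one (by linarith)]; linarith
      · change Irrational (1 / (e.ωm + k))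
        rw [one_div]; exact (hm.add_intCast k).inv
      · change Irrational (1 / (e.ωp + k))
        rw [one_div]; exact (hp.add_intCast k).inv
    · simp only [GeodesicData.shift, gaussShift, hfl]
      ext1
      · simp
      · simp
      · exact smul_inv_smul _ _

theorem shiftMatrix_smul_coe (k : ℤ) {x : ℝ} (hx : Irrational x) :
    realMatrix (shiftMatrix k) • (x : OnePoint ℝ) = ((1 / x - k : ℝ) : OnePoint ℝ) := by
  rw [realMatrix_smul_coe_eq_iff _ hx]
  have := hx.ne_zero
  simp
  field_simp
  ring

/-! ### Reduction theory: existence -/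

/-- Every pair of distinct irrational numbers is equivalent to a reduced one. If the Gauss map of
the second number never brings the first one below `-1`, then the two numbers have the same
continued fraction digits from some point on, and their distance grows at least by the factor `4`
in every two steps, which is impossible inside `(0, 1)`. -/
theorem exists_reduced {y x : ℝ} (hy : Irrational y) (hx : Irrational x) (hne : y ≠ x) :
    ∃ (A : GL (Fin 2) ℤ) (y' x' : ℝ), realMatrix A • (y : OnePoint ℝ) = y' ∧
      realMatrix A • (x : OnePoint ℝ) = x' ∧ y' < -1 ∧ 0 < x' ∧ x' < 1 := by
  by_contra! hno
  -- `(y', x')` is equivalent to `(y, x)`, and `x'` lies in the domain of the Gauss map.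
  let R (y' x' : ℝ) : Prop := Irrational y' ∧ Irrational x' ∧ 0 < x' ∧ x' < 1 ∧
    ∃ A : GL (Fin 2) ℤ, realMatrix A • (y : OnePoint ℝ) = y' ∧ realMatrix A • (x : OnePoint ℝ) = x'
  have step {y' x' : ℝ} (h : R y' x') : R (1 / y' - ⌊1 / x'⌋) (1 / x' - ⌊1 / x'⌋) := by
    obtain ⟨h1, h2, h3, h4, A, h5, h6⟩ := h
    refine ⟨irrational_one_div_sub h1 _, irrational_one_div_sub h2 _, (gauss_mem_Ioo h2).1,
      (gauss_mem_Ioo h2).2, shiftMatrix ⌊1 / x'⌋ * A, ?_, ?_⟩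
    · rw [map_mul, mul_smul, h5, shiftMatrix_smul_coe _ h1]
    · rw [map_mul, mul_smul, h6, shiftMatrix_smul_coe _ h2]
  have hge {y' x' : ℝ} (h : R y' x') : -1 ≤ y' := by
    obtain ⟨h1, h2, h3, h4, A, h5, h6⟩ := h
    by_contra! hlt
    exact absurd (hno A y' x' h5 h6 hlt h3) (not_le.2 h4)
  have hk {y' x' : ℝ} (h : R y' x') : (1 : ℝ) ≤ ⌊1 / x'⌋ := by
    exact_mod_cast one_le_floor h.2.2.1 h.2.2.2.1
  have hpos {y' x' : ℝ} (h : R y' x') : 0 < y' := by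
    by_contra! hle
    -- A negative `y'` is sent below `-1` by the next step.
    have h1 := hge (step h)
    have h2 := one_div_neg.2 (lt_of_le_of_ne hle h.1.ne_zero)
    linarith [hk h]
  have hlt {y' x' : ℝ} (h : R y' x') : y' < 1 := by
    by_contra! hle
    have h1 := hpos (step h)
    have h2 := (div_le_one (hpos h)).2 hle
    linarith [hk h]
  have hprod {z k : ℝ} (hz : 0 < z) (hk : 1 ≤ k) (h0 : 0 < 1 / z - k) (h1 : 1 / z - k < 1) :
      0 < z * (1 / z - k) ∧ z * (1 / z - k) < 1 / 2 := by
    refine ⟨mul_pos hz h0, ?_⟩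
    have e : z * (1 / z) = 1 := by field_simp
    nlinarith
  -- Each step divides the distance `|x' - y'|` by `x' y'`, and the product of two consecutive
  -- iterates of `x'` or of `y'` is less than `1 / 2`.
  have grow {y' x' : ℝ} (h : R y' x') : ∃ y'' x'', R y'' x'' ∧ 4 * |x' - y'| ≤ |x'' - y''| := by
    have h1 := step h
    have h2 := step h1
    refine ⟨_, _, h2, ?_⟩
    have px := hprod h.2.2.1 (hk h) h1.2.2.1 h1.2.2.2.1
    have py := hprod (hpos h) (hk h) (hpos h1) (hlt h1)
    have hx0 := h.2.2.1.ne'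
    have hy0 := (hpos h).ne'
    have hx1 := h1.2.2.1.ne'
    have hy1 := (hpos h1).ne'
    set k := (⌊1 / x'⌋ : ℝ)
    set x₁ := 1 / x' - k with hx₁
    set y₁ := 1 / y' - k with hy₁
    set l := (⌊1 / x₁⌋ : ℝ)
    have e : x' - y' = (1 / x₁ - l - (1 / y₁ - l)) * ((x' * x₁) * (y' * y₁)) := by
      have e1 : x' * y' * (x₁ - y₁) = y' - x' := by rw [hx₁, hy₁]; field_simp; ring
      have e2 : (1 / x₁ - l - (1 / y₁ - l)) * ((x' * x₁) * (y' * y₁)) = x' * y' * (y₁ - x₁) := by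
        field_simp
        ring
      rw [e2]; linarith
    have hq : (x' * x₁) * (y' * y₁) ≤ 1 / 4 := by nlinarith
    have hq0 : 0 < (x' * x₁) * (y' * y₁) := mul_pos px.1 py.1
    rw [e, abs_mul, abs_of_pos hq0]
    nlinarith [abs_nonneg (1 / x₁ - l - (1 / y₁ - l))]
  obtain ⟨y₀, x₀, h₀, hd⟩ : ∃ y₀ x₀, R y₀ x₀ ∧ x₀ - y₀ = x - y := by
    refine ⟨y - ⌊x⌋, x - ⌊x⌋, ⟨hy.sub_intCast _, hx.sub_intCast _, ?_, Int.fract_lt_one _,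
      shiftMatrix ⌊x⌋ * shiftMatrix 0, ?_, ?_⟩, by ring⟩
    · exact lt_of_le_of_ne (Int.fract_nonneg _) (hx.sub_intCast ⌊x⌋).ne_zero.symm
    · rw [map_mul, mul_smul, shiftMatrix_smul_coe _ hy,
        shiftMatrix_smul_coe _ (irrational_one_div_sub hy _)]
      simp
    · rw [map_mul, mul_smul, shiftMatrix_smul_coe _ hx,
        shiftMatrix_smul_coe _ (irrational_one_div_sub hx _)]
      simp
  have iter (n : ℕ) : ∃ y' x', R y' x' ∧ 4 ^ n * |x - y| ≤ |x' - y'| := by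
    induction n with
    | zero => exact ⟨y₀, x₀, h₀, by rw [hd]; simp⟩
    | succ n ih =>
      obtain ⟨y', x', h, hle⟩ := ih
      obtain ⟨y'', x'', h', hle'⟩ := grow h
      exact ⟨y'', x'', h', by rw [pow_succ]; linarith⟩
  have hpos' : 0 < |x - y| := abs_pos.2 (sub_ne_zero.2 hne.symm)
  obtain ⟨n, hn⟩ := pow_unbounded_of_one_lt (1 / |x - y|) (by norm_num : (1 : ℝ) < 4)
  obtain ⟨y', x', h, hle⟩ := iter n
  rw [div_lt_iff₀ hpos'] at hn
  have : |x' - y'| < 1 := by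
    rw [abs_lt]
    constructor <;> linarith [hpos h, hlt h, h.2.2.1, h.2.2.2.1]
  linarith

/-! ### Reduction theory: uniqueness -/

/-- The matrix `A` moves the triple `d` to the triple `e`. -/
def Moves (A : GL (Fin 2) ℤ) (d e : GeodesicData) : Prop :=
  realMatrix A • (d.ωm : OnePoint ℝ) = e.ωm ∧ realMatrix A • (d.ωp : OnePoint ℝ) = e.ωp ∧
    Matrix.ProjGenLinGroup.mk A • d.s = e.s

theorem Moves.mul {A B : GL (Fin 2) ℤ} {d e f : GeodesicData} (hB : Moves B e f)
    (hA : Moves A d e) : Moves (B * A) d f := by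
  obtain ⟨h1, h2, h3⟩ := hA
  obtain ⟨h1', h2', h3'⟩ := hB
  refine ⟨?_, ?_, ?_⟩
  · rw [map_mul, mul_smul, h1, h1']
  · rw [map_mul, mul_smul, h2, h2']
  · rw [map_mul, mul_smul, h3, h3']

theorem Moves.inv {A : GL (Fin 2) ℤ} {d e : GeodesicData} (h : Moves A d e) :
    Moves A⁻¹ e d := by
  obtain ⟨h1, h2, h3⟩ := h
  refine ⟨?_, ?_, ?_⟩
  · rw [map_inv, inv_smul_eq_iff, h1]
  · rw [map_inv, inv_smul_eq_iff, h2]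
  · rw [map_inv, inv_smul_eq_iff, h3]

theorem Moves.neg {A : GL (Fin 2) ℤ} {d e : GeodesicData} (h : Moves A d e) :
    Moves (-A) d e := by
  have hr (x : ℝ) : realMatrix (-A) • (x : OnePoint ℝ) = realMatrix A • (x : OnePoint ℝ) := by
    have e1 (a b : ℝ) : -a * x + -b = -(a * x + b) := by ring
    simp only [OnePoint.smul_some_eq_ite, realMatrix_apply, Units.val_neg, Matrix.neg_apply,
      Int.cast_neg, e1, neg_eq_zero, neg_div_neg_eq]
    by_cases h0 : (A 1 0 : ℝ) * x + A 1 1 = 0 <;> simp [h0]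
  have hs : Matrix.ProjGenLinGroup.mk (-A) = Matrix.ProjGenLinGroup.mk A := by
    rw [Matrix.ProjGenLinGroup.mk_eq_mk_iff]
    refine ⟨-1, ?_⟩
    ext i j
    simp
  exact ⟨by rw [hr, h.1], by rw [hr, h.2.1], by rw [hs, h.2.2]⟩

theorem Moves.eq_of_one {d e : GeodesicData} (h : Moves 1 d e) : d = e := by
  obtain ⟨h1, h2, h3⟩ := h
  simp only [map_one, one_smul, OnePoint.coe_eq_coe] at h1 h2 h3
  exact GeodesicData.ext h1 h2 h3

theorem moves_shift {d : GeodesicData} (hd : d ∈ irrationalData) :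
    Moves (shiftMatrix ⌊1 / d.ωp⌋) d d.shift :=
  ⟨shiftMatrix_smul_coe _ hd.2.1, shiftMatrix_smul_coe _ hd.2.2, rfl⟩

/-- If an integral matrix of determinant `±1` maps `x > 0 > y` to `x' > 0 > y'`, then, up to sign,
either the matrix or its inverse has no negative entries. -/
theorem sign_pattern {a b c d : ℤ} (hdet : a * d - b * c = 1 ∨ a * d - b * c = -1)
    {x y x' y' : ℝ} (hx : 0 < x) (hy : y < 0) (hx' : 0 < x') (hy' : y' < 0)
    (ex : a * x + b = x' * (c * x + d)) (ey : a * y + b = y' * (c * y + d)) :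
    (0 ≤ a ∧ 0 ≤ b ∧ 0 ≤ c ∧ 0 ≤ d) ∨ (a ≤ 0 ∧ b ≤ 0 ∧ c ≤ 0 ∧ d ≤ 0) ∨
    (0 ≤ a ∧ b ≤ 0 ∧ c ≤ 0 ∧ 0 ≤ d) ∨ (a ≤ 0 ∧ 0 ≤ b ∧ 0 ≤ c ∧ d ≤ 0) := by
  wlog hs : 0 ≤ c * x + d generalizing a b c d
  · have := this (a := -a) (b := -b) (c := -c) (d := -d) (by simpa using hdet)
      (by push_cast; linarith) (by push_cast; linarith) (by push_cast; linarith)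
    simp only [Left.nonneg_neg_iff, Left.neg_nonpos_iff] at this
    tauto
  -- With `c x + d > 0`, this identity shows that the sign of `c y + d` is that of the determinant.
  have key : (x' - y') * (c * x + d) * (c * y + d) = (a * d - b * c : ℤ) * (x - y) := by
    push_cast
    linear_combination -(c * y + d) * ex + (c * x + d) * ey
  have hxy : 0 < x - y := by linarith
  have hxy' : 0 < x' - y' := by linarith
  have hs' : 0 < c * x + d := by
    refine lt_of_le_of_ne hs fun h => ?_
    rw [← h] at key
    rcases hdet with h' | h' <;> rw [h'] at key <;> push_cast at key <;> linarith
  have hax : 0 < a * x + b := by rw [ex]; exact mul_pos hx' hs'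
  have hp : 0 < (x' - y') * (c * x + d) := mul_pos hxy' hs'
  rcases hdet with hdet | hdet <;> rw [hdet] at key <;> push_cast at key
  · -- Determinant `1`: both diagonal entries are positive, so `b c = a d - 1 ≥ 0`.
    have hcy : 0 < c * y + d := by
      by_contra! hle
      nlinarith
    have hay : a * y + b < 0 := by rw [ey]; exact mul_neg_of_neg_of_pos hy' hcy
    have ha : 0 < a := by
      have : (0 : ℝ) < a := by
        by_contra! hle
        nlinarith
      exact_mod_cast this
    have hd : 0 < d := by
      have : (0 : ℝ) < d := by
        by_contra! hle
        nlinarith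
      exact_mod_cast this
    have hbc : 0 ≤ b * c := by nlinarith
    rcases mul_nonneg_iff.1 hbc with h | h
    · left; omega
    · right; right; left; omega
  · -- Determinant `-1`: both off-diagonal entries are positive, so `a d = b c - 1 ≥ 0`.
    have hcy : c * y + d < 0 := by
      by_contra! hle
      nlinarith
    have hay : 0 < a * y + b := by rw [ey]; exact mul_pos_of_neg_of_neg hy' hcy
    have hb : 0 < b := by
      have : (0 : ℝ) < b := by
        by_contra! hle
        nlinarith
      exact_mod_cast this
    have hc : 0 < c := by
      have : (0 : ℝ) < c := by
        by_contra! hle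
        nlinarith
      exact_mod_cast this
    have had : 0 ≤ a * d := by nlinarith
    rcases mul_nonneg_iff.1 had with h | h
    · left; omega
    · right; right; right; omega

theorem Moves.sign_pattern {A : GL (Fin 2) ℤ} {d e : GeodesicData} (hd : d ∈ irrationalData)
    (he : e ∈ irrationalData) (h : Moves A d e) :
    (0 ≤ A 0 0 ∧ 0 ≤ A 0 1 ∧ 0 ≤ A 1 0 ∧ 0 ≤ A 1 1) ∨
    (A 0 0 ≤ 0 ∧ A 0 1 ≤ 0 ∧ A 1 0 ≤ 0 ∧ A 1 1 ≤ 0) ∨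
    (0 ≤ A 0 0 ∧ A 0 1 ≤ 0 ∧ A 1 0 ≤ 0 ∧ 0 ≤ A 1 1) ∨
    (A 0 0 ≤ 0 ∧ 0 ≤ A 0 1 ∧ 0 ≤ A 1 0 ∧ A 1 1 ≤ 0) := by
  obtain ⟨h1, h2, h3, hm, hp⟩ := mem_irrationalData_iff.1 hd
  obtain ⟨h1', h2', h3', -, -⟩ := mem_irrationalData_iff.1 he
  exact Mixmaster.sign_pattern (det_eq_one_or_neg_one A) h2 (by linarith) h2' (by linarith)
    ((realMatrix_smul_coe_eq_iff A hp).1 h.2.1) ((realMatrix_smul_coe_eq_iff A hm).1 h.1)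

theorem gl_eq_one_of {A : GL (Fin 2) ℤ} (h00 : A 0 0 = 1) (h01 : A 0 1 = 0) (h10 : A 1 0 = 0)
    (h11 : A 1 1 = 1) : A = 1 := by
  ext i j
  fin_cases i <;> fin_cases j <;> simp [h00, h01, h10, h11]

/-- A matrix without negative entries that moves a reduced triple `e` to a reduced triple `d`
is a product of matrices `(0 1; 1 k)` with the continued fraction digits `k` of `d`: otherwise
splitting off the first digit leaves a matrix of the same kind with a smaller sum of entries. -/
theorem exists_iterate_shift_of_nonneg (n : ℕ) : ∀ {A : GL (Fin 2) ℤ} {d e : GeodesicData},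
    d ∈ irrationalData → e ∈ irrationalData → Moves A e d →
    0 ≤ A 0 0 → 0 ≤ A 0 1 → 0 ≤ A 1 0 → 0 ≤ A 1 1 → A 0 0 + A 0 1 + A 1 0 + A 1 1 ≤ n →
    ∃ m : ℕ, GeodesicData.shift^[m] d = e := by
  induction n with
  | zero =>
    intro A d e _ _ _ h00 h01 h10 h11 hn
    have h : A 0 0 = 0 ∧ A 0 1 = 0 := by constructor <;> push_cast at hn <;> omega
    rcases det_eq_one_or_neg_one A with h' | h' <;> simp [h] at h'
  | succ n ih =>
    intro A d e hd he hA h00 h01 h10 h11 hn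
    obtain ⟨y1, x1, x2, hm, hp⟩ := mem_irrationalData_iff.1 hd
    obtain ⟨y1', x1', x2', hm', hp'⟩ := mem_irrationalData_iff.1 he
    set k := ⌊1 / d.ωp⌋ with hk
    have hk1 : 1 ≤ k := one_le_floor x1 x2
    have hB : Moves (shiftMatrix k * A) e d.shift := (moves_shift hd).mul hA
    have hds := shift_mem hd
    have b00 : (shiftMatrix k * A) 0 0 = -k * A 0 0 + A 1 0 := by
      simp [Matrix.mul_apply, Fin.sum_univ_two]
    have b01 : (shiftMatrix k * A) 0 1 = -k * A 0 1 + A 1 1 := by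
      simp [Matrix.mul_apply, Fin.sum_univ_two]
    have b10 : (shiftMatrix k * A) 1 0 = A 0 0 := by
      simp [Matrix.mul_apply, Fin.sum_univ_two]
    have b11 : (shiftMatrix k * A) 1 1 = A 0 1 := by
      simp [Matrix.mul_apply, Fin.sum_univ_two]
    rcases h00.eq_or_lt with ha | ha
    · -- `A = (0 1; 1 l)`; then `l` has to be the first digit `k`.
      have hbc : A 0 1 * A 1 0 = 1 := by
        rcases det_eq_one_or_neg_one A with h' | h' <;> rw [← ha] at h' <;> nlinarith
      have hb : A 0 1 = 1 := Int.eq_one_of_mul_eq_one_right h01 hbc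
      have hc : A 1 0 = 1 := by rwa [hb, one_mul] at hbc
      obtain ⟨-, z1, z2, -, -⟩ := mem_irrationalData_iff.1 hds
      have hdk : -k + A 1 1 = 0 := by
        have ex := (realMatrix_smul_coe_eq_iff _ hp').1 hB.2.1
        rw [b00, b01, b10, b11, ← ha, hb, hc] at ex
        push_cast at ex
        have l1 : ((-1 : ℤ) : ℝ) < ((-k + A 1 1 : ℤ) : ℝ) := by push_cast; linarith
        have l2 : ((-k + A 1 1 : ℤ) : ℝ) < ((1 : ℤ) : ℝ) := by push_cast; linarith
        have l1' := Int.cast_lt.1 l1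
        have l2' := Int.cast_lt.1 l2
        omega
      have hB1 : shiftMatrix k * A = 1 :=
        gl_eq_one_of (by rw [b00, ← ha, hc]; simp) (by rw [b01, hb, mul_one, hdk])
          (by rw [b10, ha]) (by rw [b11, hb])
      exact ⟨1, (hB1 ▸ hB).eq_of_one.symm⟩
    rcases h01.eq_or_lt with hb | hb
    · -- `A = (1 0; c 1)`; then `1 / ω⁻ ∈ (-1, 0)` for both triples forces `c = 0`.
      have had : A 0 0 * A 1 1 = 1 := by
        rcases det_eq_one_or_neg_one A with h' | h' <;> rw [← hb] at h' <;> nlinarith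
      have ha : A 0 0 = 1 := Int.eq_one_of_mul_eq_one_right h00 had
      have hd1 : A 1 1 = 1 := by rwa [ha, one_mul] at had
      have hc : A 1 0 = 0 := by
        have ey := (realMatrix_smul_coe_eq_iff A hm').1 hA.1
        rw [ha, ← hb, hd1] at ey
        push_cast at ey
        by_contra hc
        have hc1 : (1 : ℝ) ≤ A 1 0 := by
          have : 1 ≤ A 1 0 := by omega
          exact_mod_cast this
        have : 0 < d.ωm * e.ωm := mul_pos_of_neg_of_neg (by linarith) (by linarith)
        nlinarith
      exact ⟨0, (gl_eq_one_of ha hb.symm hc hd1 ▸ hA).eq_of_one.symm⟩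
    · -- The lower row of `shiftMatrix k * A` is the positive upper row of `A`.
      have hpat := hB.sign_pattern he hds
      rw [b00, b01, b10, b11] at hpat
      obtain ⟨h1, h2, h3, h4⟩ : 0 ≤ -k * A 0 0 + A 1 0 ∧ 0 ≤ -k * A 0 1 + A 1 1 ∧ 0 ≤ A 0 0 ∧
          0 ≤ A 0 1 := by omega
      obtain ⟨m, hm⟩ := ih hds he hB (by rwa [b00]) (by rwa [b01]) (by rwa [b10]) (by rwa [b11])
        (by rw [b00, b01, b10, b11]; push_cast at hn; nlinarith)
      exact ⟨m + 1, hm⟩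

/-- Reduced triples that are equivalent under `PGL(2, ℤ)` lie on the same orbit of the shift. -/
theorem exists_iterate_shift {A : GL (Fin 2) ℤ} {d e : GeodesicData} (hd : d ∈ irrationalData)
    (he : e ∈ irrationalData) (h : Moves A d e) :
    ∃ m : ℕ, GeodesicData.shift^[m] d = e ∨ GeodesicData.shift^[m] e = d := by
  have pos {B : GL (Fin 2) ℤ} {d e : GeodesicData} (hd : d ∈ irrationalData)
      (he : e ∈ irrationalData) (hB : Moves B e d) (h00 : 0 ≤ B 0 0) (h01 : 0 ≤ B 0 1)
      (h10 : 0 ≤ B 1 0) (h11 : 0 ≤ B 1 1) : ∃ m : ℕ, GeodesicData.shift^[m] d = e :=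
    exists_iterate_shift_of_nonneg (B 0 0 + B 0 1 + B 1 0 + B 1 1).toNat hd he hB h00 h01 h10 h11
      (Int.self_le_toNat _)
  have hmul : (A * A⁻¹ : GL (Fin 2) ℤ) = 1 := mul_inv_cancel A
  have hij (i j : Fin 2) : A i 0 * A⁻¹ 0 j + A i 1 * A⁻¹ 1 j = (1 : GL (Fin 2) ℤ) i j := by
    rw [← hmul, Units.val_mul, Matrix.mul_apply, Fin.sum_univ_two]
  have e00 := hij 0 0
  have e01 := hij 0 1
  have e10 := hij 1 0
  have e11 := hij 1 1
  simp only [Units.val_one, Matrix.one_apply_eq, ne_eq, zero_ne_one, one_ne_zero,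
    not_false_eq_true, Matrix.one_apply_ne] at e00 e01 e10 e11
  set Δ := A 0 0 * A 1 1 - A 0 1 * A 1 0 with hΔ
  have i00 : A⁻¹ 0 0 * Δ = A 1 1 := by rw [hΔ]; linear_combination A 1 1 * e00 - A 0 1 * e10
  have i01 : A⁻¹ 0 1 * Δ = -A 0 1 := by rw [hΔ]; linear_combination A 1 1 * e01 - A 0 1 * e11
  have i10 : A⁻¹ 1 0 * Δ = -A 1 0 := by rw [hΔ]; linear_combination A 0 0 * e10 - A 1 0 * e00
  have i11 : A⁻¹ 1 1 * Δ = A 0 0 := by rw [hΔ]; linear_combination A 0 0 * e11 - A 1 0 * e01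
  have neg_apply (B : GL (Fin 2) ℤ) (i j : Fin 2) : (-B) i j = -(B i j) := rfl
  have hinv : (0 ≤ A⁻¹ 0 0 ∧ 0 ≤ A⁻¹ 0 1 ∧ 0 ≤ A⁻¹ 1 0 ∧ 0 ≤ A⁻¹ 1 1) ∨
      (A⁻¹ 0 0 ≤ 0 ∧ A⁻¹ 0 1 ≤ 0 ∧ A⁻¹ 1 0 ≤ 0 ∧ A⁻¹ 1 1 ≤ 0) →
      ∃ m : ℕ, GeodesicData.shift^[m] d = e := by
    rintro (⟨h1, h2, h3, h4⟩ | ⟨h1, h2, h3, h4⟩)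
    · exact pos hd he h.inv h1 h2 h3 h4
    · refine pos hd he h.inv.neg ?_ ?_ ?_ ?_ <;> rw [neg_apply] <;> omega
  rcases h.sign_pattern hd he with ⟨h1, h2, h3, h4⟩ | ⟨h1, h2, h3, h4⟩ | ⟨h1, h2, h3, h4⟩ |
    ⟨h1, h2, h3, h4⟩
  · obtain ⟨m, hm⟩ := pos he hd h h1 h2 h3 h4
    exact ⟨m, .inr hm⟩
  · obtain ⟨m, hm⟩ := pos he hd h.neg (by rw [neg_apply]; omega) (by rw [neg_apply]; omega)
      (by rw [neg_apply]; omega) (by rw [neg_apply]; omega)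
    exact ⟨m, .inr hm⟩
  all_goals
    obtain ⟨m, hm⟩ := hinv (by
      rcases det_eq_one_or_neg_one A with h' | h' <;> rw [← hΔ] at h' <;>
        rw [h'] at i00 i01 i10 i11 <;> omega)
    exact ⟨m, .inl hm⟩

/-! ### Lifts of geodesics -/

/-- Two lifts of a geodesic differ by an element of `Γ₀(2)`: for every time some element of the
countable group maps one lift to the other one, so some element does so at two different times. -/
theorem exists_smul_eq_of_lift {γ : ℝ → ModularCurve} {c c' : ℝ → ℍ} (hc : IsGeodesicLift c γ)
    (hc' : IsGeodesicLift c' γ) : ∃ h ∈ Gamma0Two, ∀ t, c' t = h • c t := by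
  have hex (t : ℝ) : ∃ h ∈ Gamma0Two, h • c t = c' t :=
    quotientMap_eq_iff.1 (by rw [← hc.2, ← hc'.2])
  choose f hf hft using hex
  have hni : ¬ Function.Injective f := fun hinj => by
    have := countable_pgl
    exact not_countable (α := ℝ) hinj.countable
  simp only [Function.Injective, not_forall] at hni
  obtain ⟨t₁, t₂, heq, hne⟩ := hni
  refine ⟨f t₁, hf t₁, fun t => ?_⟩
  have := isometry_eq_of_eq_at_two ((isometry_pgl_smul (f t₁)).comp hc.1) hc'.1 hne
    (hft t₁).symm (by rw [Function.comp, heq, hft])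
  rw [this]
  rfl

theorem TendsToBoundary.pgl_smul {c : ℝ → ℍ} (hc : Isometry c) {ξ η : OnePoint ℝ}
    (hξ : TendsToBoundary c atBot ξ) (hη : TendsToBoundary c atTop η) (A : GL (Fin 2) ℤ) :
    TendsToBoundary (fun t => Matrix.ProjGenLinGroup.mk A • c t) atBot (realMatrix A • ξ) ∧
      TendsToBoundary (fun t => Matrix.ProjGenLinGroup.mk A • c t) atTop (realMatrix A • η) :=
  TendsToBoundary.gl_smul hc hξ hη (realMatrix A)

/-- The triples that code a geodesic are the reduced ones in the `PGL(2, ℤ)`-orbit of the end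
points of a lift, taken together with the point `∞` of `P¹(𝔽₂)`. -/
theorem codes_iff {γ : ℝ → ModularCurve} {c : ℝ → ℍ} (hc : IsGeodesicLift c γ) {ξ η : OnePoint ℝ}
    (hξ : TendsToBoundary c atBot ξ) (hη : TendsToBoundary c atTop η) (d : GeodesicData) :
    Codes d γ ↔ d ∈ reducedData ∧ ∃ A : GL (Fin 2) ℤ, realMatrix A • ξ = d.ωm ∧
      realMatrix A • η = d.ωp ∧ Matrix.ProjGenLinGroup.mk A • pointInfty = d.s := by
  constructor
  · rintro ⟨hd, c', hc', hm, hp, g, hg, hγ⟩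
    refine ⟨hd, ?_⟩
    obtain ⟨h, hh, hch⟩ := exists_smul_eq_of_lift hc
      (c' := fun t => g⁻¹ • c' t) ⟨(isometry_pgl_smul g⁻¹).comp hc', hγ⟩
    obtain ⟨A, hA⟩ := Matrix.ProjGenLinGroup.mk_surjective (g * h)
    have hc'eq : c' = fun t => Matrix.ProjGenLinGroup.mk A • c t := by
      funext t
      rw [hA, mul_smul, ← hch, smul_inv_smul]
    have hends := TendsToBoundary.pgl_smul hc.1 hξ hη A
    rw [← hc'eq] at hends
    refine ⟨A, tendsToBoundary_unique hends.1 hm, tendsToBoundary_unique hends.2 hp, ?_⟩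
    rw [hA, mul_smul, (mem_Gamma0Two_iff h).1 hh, hg]
  · rintro ⟨hd, A, hm, hp, hs⟩
    have hends := TendsToBoundary.pgl_smul hc.1 hξ hη A
    rw [hm, hp] at hends
    exact ⟨hd, _, (isometry_pgl_smul _).comp hc.1, hends.1, hends.2, _, hs, fun t => by
      rw [Function.comp, inv_smul_smul, hc.2]⟩

theorem exists_lift_of_not_endsAtCusp {γ : ℝ → ModularCurve} (hγ : IsInfiniteGeodesic γ)
    (hcusp : ¬ EndsAtCusp γ) : ∃ (c : ℝ → ℍ) (y x : ℝ), IsGeodesicLift c γ ∧ Irrational y ∧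
      Irrational x ∧ y ≠ x ∧ TendsToBoundary c atBot (y : OnePoint ℝ) ∧
      TendsToBoundary c atTop (x : OnePoint ℝ) := by
  obtain ⟨c, hc⟩ := hγ
  obtain ⟨ξ, η, hne, hξ, hη⟩ := exists_endpoints hc.1
  obtain ⟨y, hy, rfl⟩ := exists_irrational_of_notMem_cuspSet
    (fun h => hcusp ⟨c, hc, ξ, h, .inl hξ⟩)
  obtain ⟨x, hx, rfl⟩ := exists_irrational_of_notMem_cuspSet
    (fun h => hcusp ⟨c, hc, η, h, .inr hη⟩)
  exact ⟨c, y, x, hc, hy, hx, fun h => hne (by rw [h]), hξ, hη⟩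

theorem mem_irrationalData_of_codes {γ : ℝ → ModularCurve} (hγ : IsInfiniteGeodesic γ)
    (hcusp : ¬ EndsAtCusp γ) {d : GeodesicData} (hd : Codes d γ) : d ∈ irrationalData := by
  obtain ⟨c, y, x, hc, hy, hx, -, hcy, hcx⟩ := exists_lift_of_not_endsAtCusp hγ hcusp
  obtain ⟨hd, A, hm, hp, -⟩ := (codes_iff hc hcy hcx d).1 hd
  refine ⟨hd, ?_, ?_⟩
  · rw [← not_not (a := Irrational _), ← coe_mem_cuspSet_iff, ← hm, smul_mem_cuspSet_iff,
      coe_mem_cuspSet_iff, not_not]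
    exact hy
  · rw [← not_not (a := Irrational _), ← coe_mem_cuspSet_iff, ← hp, smul_mem_cuspSet_iff,
      coe_mem_cuspSet_iff, not_not]
    exact hx

theorem exists_codes {γ : ℝ → ModularCurve} (hγ : IsInfiniteGeodesic γ)
    (hcusp : ¬ EndsAtCusp γ) : ∃ d, Codes d γ := by
  obtain ⟨c, y, x, hc, hy, hx, hne, hcy, hcx⟩ := exists_lift_of_not_endsAtCusp hγ hcusp
  obtain ⟨A, y', x', hA, hA', h1, h2, h3⟩ := exists_reduced hy hx hne
  exact ⟨⟨y', x', Matrix.ProjGenLinGroup.mk A • pointInfty⟩,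
    (codes_iff hc hcy hcx _).2 ⟨⟨h1.le, h2.le, h3.le⟩, A, hA, hA', rfl⟩⟩

theorem Codes.of_moves {γ : ℝ → ModularCurve} (hγ : IsInfiniteGeodesic γ) {d e : GeodesicData}
    (hd : Codes d γ) (he : e ∈ reducedData) {B : GL (Fin 2) ℤ} (hB : Moves B d e) :
    Codes e γ := by
  obtain ⟨c, hc⟩ := hγ
  obtain ⟨ξ, η, -, hξ, hη⟩ := exists_endpoints hc.1
  obtain ⟨-, A, h1, h2, h3⟩ := (codes_iff hc hξ hη d).1 hd
  obtain ⟨h1', h2', h3'⟩ := hB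
  refine (codes_iff hc hξ hη e).2 ⟨he, B * A, ?_, ?_, ?_⟩
  · rw [map_mul, mul_smul, h1, h1']
  · rw [map_mul, mul_smul, h2, h2']
  · rw [map_mul, mul_smul, h3, h3']

theorem Codes.exists_moves {γ : ℝ → ModularCurve} (hγ : IsInfiniteGeodesic γ) {d e : GeodesicData}
    (hd : Codes d γ) (he : Codes e γ) : ∃ B, Moves B d e := by
  obtain ⟨c, hc⟩ := hγ
  obtain ⟨ξ, η, -, hξ, hη⟩ := exists_endpoints hc.1
  obtain ⟨-, A, h1, h2, h3⟩ := (codes_iff hc hξ hη d).1 hd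
  obtain ⟨-, B, h1', h2', h3'⟩ := (codes_iff hc hξ hη e).1 he
  refine ⟨B * A⁻¹, ?_, ?_, ?_⟩
  · rw [map_mul, map_inv, mul_smul, ← h1, inv_smul_smul, h1']
  · rw [map_mul, map_inv, mul_smul, ← h2, inv_smul_smul, h2']
  · rw [map_mul, map_inv, mul_smul, ← h3, inv_smul_smul, h3']

theorem exists_geodesic_of_mem {d : GeodesicData} (hd : d ∈ irrationalData) :
    ∃ γ : ℝ → ModularCurve, IsInfiniteGeodesic γ ∧ ¬ EndsAtCusp γ ∧ Codes d γ := by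
  obtain ⟨h1, h2, h3, hm, hp⟩ := mem_irrationalData_iff.1 hd
  obtain ⟨c, hc, hcm, hcp⟩ := exists_geodesic (show d.ωm ≠ d.ωp by linarith)
  obtain ⟨g, hg⟩ := exists_smul_pointInfty d.s
  have hlift : IsGeodesicLift (fun t => g⁻¹ • c t) (fun t => quotientMap (g⁻¹ • c t)) :=
    ⟨(isometry_pgl_smul g⁻¹).comp hc, fun _ => rfl⟩
  refine ⟨fun t => quotientMap (g⁻¹ • c t), ⟨_, hlift⟩, ?_, hd.1, c, hc, hcm, hcp, g, hg,
    fun _ => rfl⟩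
  rintro ⟨c', hc', ξ, hξ, hlim⟩
  obtain ⟨h, -, hh⟩ := exists_smul_eq_of_lift hlift hc'
  obtain ⟨A, hA⟩ := Matrix.ProjGenLinGroup.mk_surjective (h * g⁻¹)
  have hc'eq : c' = fun t => Matrix.ProjGenLinGroup.mk A • c t := by
    funext t
    rw [hh, hA, mul_smul]
  have hends := TendsToBoundary.pgl_smul hc hcm hcp A
  rw [← hc'eq] at hends
  rcases hlim with hlim | hlim
  · rw [tendsToBoundary_unique hlim hends.1, smul_mem_cuspSet_iff, coe_mem_cuspSet_iff] at hξ
    exact hξ hm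
  · rw [tendsToBoundary_unique hlim hends.2, smul_mem_cuspSet_iff, coe_mem_cuspSet_iff] at hξ
    exact hξ hp

/-- Equal end points give equal geodesics up to a shift of the parameter, and the identification of
`P¹(𝔽₂)` with the cosets of `Γ₀(2)` makes the choice of `g` with `g • ∞ = s` irrelevant. -/
theorem exists_common_codes_iff {γ γ' : ℝ → ModularCurve} (hγ : IsInfiniteGeodesic γ)
    (hcusp : ¬ EndsAtCusp γ) :
    (∃ d, Codes d γ ∧ Codes d γ') ↔ ∃ t₀ : ℝ, ∀ t, γ' t = γ (t + t₀) := by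
  constructor
  · rintro ⟨d, ⟨-, c, hc, hm, hp, g, hg, hcγ⟩, -, c', hc', hm', hp', g', hg', hcγ'⟩
    obtain ⟨t₀, ht₀⟩ := exists_eq_comp_add hc hc' hm hp hm' hp'
    refine ⟨t₀, fun t => ?_⟩
    rw [hcγ, hcγ', ht₀, quotientMap_eq_iff]
    refine ⟨g'⁻¹ * g, ?_, by rw [mul_smul, smul_inv_smul]⟩
    rw [mem_Gamma0Two_iff, mul_smul, hg, inv_smul_eq_iff, hg']
  · rintro ⟨t₀, ht₀⟩
    obtain ⟨d, hd⟩ := exists_codes hγ hcusp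
    refine ⟨d, hd, ?_⟩
    obtain ⟨hd, c, hc, hm, hp, g, hg, hcγ⟩ := hd
    exact ⟨hd, fun t => c (t + t₀), hc.comp (IsometryEquiv.addRight t₀).isometry,
      hm.comp (tendsto_atBot_add_const_right _ _ tendsto_id),
      hp.comp (tendsto_atTop_add_const_right _ _ tendsto_id), g, hg,
      fun t => by rw [ht₀, hcγ]⟩

/-! ### Two-sided orbits -/

theorem zpow_add_one_apply {α : Type*} (e : Equiv.Perm α) (n : ℤ) (a : α) :
    (e ^ (n + 1)) a = e ((e ^ n) a) := by
  rw [add_comm, zpow_add, zpow_one, Equiv.Perm.mul_apply]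

theorem exists_shift_orbit {d : GeodesicData} (hd : d ∈ irrationalData) :
    ∃ D : ℤ → GeodesicData, D 0 = d ∧ (∀ n, D n ∈ irrationalData) ∧
      ∀ n, D (n + 1) = (D n).shift := by
  let e : Equiv.Perm irrationalData := Set.BijOn.equiv _ shift_bijOn
  refine ⟨fun n => ((e ^ n) ⟨d, hd⟩ : irrationalData), by simp, fun n => Subtype.coe_prop _,
    fun n => ?_⟩
  simp only [zpow_add_one_apply]
  rfl

theorem orbit_add_natCast {D : ℤ → GeodesicData} (hD : ∀ n, D (n + 1) = (D n).shift) (n : ℤ)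
    (m : ℕ) : D (n + m) = GeodesicData.shift^[m] (D n) := by
  induction m with
  | zero => simp
  | succ m ih =>
    rw [Function.iterate_succ_apply', ← ih, ← hD]
    congr 1
    push_cast
    ring

/-- A two-sided orbit of the shift is determined by one of its members. -/
theorem orbit_eq_of_eq {D E : ℤ → GeodesicData} (hD : ∀ n, D (n + 1) = (D n).shift)
    (hD' : ∀ n, D n ∈ irrationalData) (hE : ∀ n, E (n + 1) = (E n).shift)
    (hE' : ∀ n, E n ∈ irrationalData) {m : ℤ} (h : E 0 = D m) (n : ℤ) : E n = D (n + m) := by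
  induction n using Int.induction_on with
  | zero => rw [h, zero_add]
  | succ n ih =>
    rw [hE, ih, ← hD]
    congr 1
    ring
  | pred n ih =>
    refine shift_bijOn.injOn (hE' _) (hD' _) ?_
    rw [← hE, ← hD, sub_add_cancel, ih]
    congr 1
    ring

theorem exists_codingOrbit {γ : ℝ → ModularCurve} (hγ : IsInfiniteGeodesic γ)
    (hcusp : ¬ EndsAtCusp γ) :
    ∃ D : ℤ → GeodesicData, IsCodingOrbit D γ ∧ ∀ d, Codes d γ ↔ ∃ n, d = D n := by
  obtain ⟨d₀, hd₀⟩ := exists_codes hγ hcusp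
  have hi₀ := mem_irrationalData_of_codes hγ hcusp hd₀
  obtain ⟨D, hD0, hDi, hD⟩ := exists_shift_orbit hi₀
  have hcodes (n : ℤ) : Codes (D n) γ := by
    induction n using Int.induction_on with
    | zero => rwa [hD0]
    | succ n ih => exact ih.of_moves hγ (hDi _).1 (by rw [hD]; exact moves_shift (hDi _))
    | pred n ih =>
      refine ih.of_moves hγ (hDi _).1 (Moves.inv ?_) (B := (shiftMatrix ⌊1 / (D (-n - 1)).ωp⌋)⁻¹)
      have := moves_shift (hDi (-n - 1))
      rwa [← hD, sub_add_cancel] at this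
  refine ⟨D, fun n => ⟨hcodes n, hD n⟩, fun d => ⟨fun hd => ?_, ?_⟩⟩
  · obtain ⟨B, hB⟩ := hd.exists_moves hγ hd₀
    have hi := mem_irrationalData_of_codes hγ hcusp hd
    obtain ⟨m, hm | hm⟩ := exists_iterate_shift hi hi₀ hB
    · refine ⟨-m, (shift_bijOn.iterate m).injOn hi (hDi _) ?_⟩
      rw [hm, ← orbit_add_natCast hD, neg_add_cancel, hD0]
    · exact ⟨m, by rw [← hm, ← hD0, ← orbit_add_natCast hD, zero_add]⟩
  · rintro ⟨n, rfl⟩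
    exact hcodes n

/-! ### Mixmaster universes -/

/-- The permutation of the axes from the beginning of an era with `k` cycles to the beginning of
the next one. -/
def eraPerm (k : ℤ) : Equiv.Perm Axis :=
  if Even k then Equiv.swap Axis.y Axis.z else Equiv.swap Axis.y Axis.z * Equiv.swap Axis.x Axis.y

theorem shiftElement_smul_axisPoint (k : ℤ) (b : Axis) :
    shiftElement k • axisPoint b = axisPoint (eraPerm k b) := by
  by_cases hk : Even k
  · rw [eraPerm, if_pos hk, shiftElement_smul_of_even hk]
  · rw [eraPerm, if_neg hk, shiftElement_smul_of_odd (Int.not_even_iff_odd.1 hk)]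

theorem KasnerCycle.next_iterate (S : KasnerCycle) (k : ℕ) :
    KasnerCycle.next^[k] S = ⟨S.u - k, Equiv.swap Axis.x Axis.y ^ k * S.frame⟩ := by
  induction k with
  | zero => simp
  | succ k ih =>
    rw [Function.iterate_succ_apply', ih]
    ext1
    · simp only [KasnerCycle.next]
      push_cast
      ring
    · simp only [KasnerCycle.next, pow_succ', mul_assoc]

theorem KasnerCycle.bounce_next_iterate (S : KasnerCycle) (k : ℕ) :
    (KasnerCycle.next^[k] S).bounce = ⟨1 / (S.u - k), eraPerm k * S.frame⟩ := by
  rw [KasnerCycle.next_iterate, KasnerCycle.bounce, eraPerm]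
  congr 1
  rw [← mul_assoc]
  congr 1
  by_cases hk : Even k
  · obtain ⟨j, rfl⟩ := hk
    rw [if_pos (by simp), ← two_mul, pow_mul, sq, Equiv.swap_mul_self, one_pow, mul_one]
  · rw [if_neg (by simpa using hk)]
    obtain ⟨j, rfl⟩ := Nat.not_even_iff_odd.1 hk
    rw [pow_succ, pow_mul, sq, Equiv.swap_mul_self, one_pow, one_mul]

/-- An era with initial parameter `u` consists of `⌊u⌋` cycles, since the bounce occurs at the only
`k` with `0 < u - k < 1`. -/
theorem MixmasterUniverse.era_succ_eq_bounce (U : MixmasterUniverse) (n : ℤ) {k : ℕ}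
    (hk : (k : ℤ) = ⌊(U.era n).u⌋) :
    U.era (n + 1) = (KasnerCycle.next^[k] (U.era n)).bounce := by
  obtain ⟨j, h0, h1, h⟩ := U.transition n
  rw [KasnerCycle.next_iterate] at h0 h1
  simp only at h0 h1
  have : ⌊(U.era n).u⌋ = j := by
    rw [Int.floor_eq_iff]
    push_cast
    constructor <;> linarith
  rw [this] at hk
  obtain rfl : k = j := by exact_mod_cast hk
  exact h

theorem MixmasterUniverse.era_succ (U : MixmasterUniverse) (n : ℤ) :
    U.era (n + 1) =
      ⟨1 / ((U.era n).u - ⌊(U.era n).u⌋), eraPerm ⌊(U.era n).u⌋ * (U.era n).frame⟩ := by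
  obtain ⟨k, hk⟩ := Int.eq_ofNat_of_zero_le
    (Int.floor_nonneg.2 (zero_le_one.trans (U.one_lt_u n).le))
  rw [U.era_succ_eq_bounce n hk.symm, KasnerCycle.bounce_next_iterate, hk]
  simp

/-- A recursion by left multiplication in a group has a two-sided solution, with any initial
value. -/
theorem exists_int_seq {G : Type*} [Group G] (σ : ℤ → G) (g : G) :
    ∃ F : ℤ → G, F 0 = g ∧ ∀ n, F (n + 1) = σ n * F n := by
  let e : Equiv.Perm (ℤ × G) :=
    { toFun := fun p => (p.1 + 1, σ p.1 * p.2)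
      invFun := fun p => (p.1 - 1, (σ (p.1 - 1))⁻¹ * p.2)
      left_inv := fun p => by simp
      right_inv := fun p => by simp }
  have hfst (n : ℤ) : ((e ^ n) (0, g)).1 = n := by
    induction n using Int.induction_on with
    | zero => simp
    | succ n ih =>
      rw [zpow_add_one_apply]
      change ((e ^ (n : ℤ)) (0, g)).1 + 1 = _
      rw [ih]
    | pred n ih =>
      have h := zpow_add_one_apply e (-n - 1) (0, g)
      rw [sub_add_cancel] at h
      rw [h] at ih
      change ((e ^ (-n - 1 : ℤ)) (0, g)).1 + 1 = _ at ih
      linarith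
  refine ⟨fun n => ((e ^ n) (0, g)).2, by simp, fun n => ?_⟩
  simp only [zpow_add_one_apply]
  change σ ((e ^ n) (0, g)).1 * _ = _
  rw [hfst]

theorem one_lt_one_div_ωp {d : GeodesicData} (hd : d ∈ irrationalData) : 1 < 1 / d.ωp := by
  obtain ⟨-, h1, h2, -, -⟩ := mem_irrationalData_iff.1 hd
  exact (one_lt_div h1).2 h2

theorem exists_describes {D : ℤ → GeodesicData} (hDi : ∀ n, D n ∈ irrationalData)
    (hD : ∀ n, D (n + 1) = (D n).shift) (a : Axis) : ∃ U, Describes D a U := by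
  obtain ⟨b, hb⟩ := axisPoint_bijective.2 (D 0).s
  obtain ⟨F, hF0, hF⟩ := exists_int_seq (fun n => eraPerm ⌊1 / (D n).ωp⌋) (Equiv.swap a b)
  refine ⟨⟨fun n => ⟨1 / (D n).ωp, F n⟩, fun n => one_lt_one_div_ωp (hDi n), fun n => ?_⟩,
    fun n => ⟨rfl, ?_⟩⟩
  · obtain ⟨k, hk⟩ := Int.eq_ofNat_of_zero_le
      (Int.floor_nonneg.2 (zero_le_one.trans (one_lt_one_div_ωp (hDi n)).le))
    have h := gauss_mem_Ioo (hDi n).2.2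
    rw [hk] at h
    refine ⟨k, ?_, ?_, ?_⟩
    · rw [KasnerCycle.next_iterate]; exact_mod_cast h.1
    · rw [KasnerCycle.next_iterate]; exact_mod_cast h.2
    · rw [KasnerCycle.bounce_next_iterate, hF, hD, hk]
      simp only [GeodesicData.shift, gaussShift, hk, Int.cast_natCast]
  · have hs (n : ℤ) : (D (n + 1)).s = shiftElement ⌊1 / (D n).ωp⌋ • (D n).s := by rw [hD]; rfl
    have hF' (n : ℤ) : axisPoint (F (n + 1) a) =
        shiftElement ⌊1 / (D n).ωp⌋ • axisPoint (F n a) := by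
      rw [shiftElement_smul_axisPoint, hF, Equiv.Perm.mul_apply]
    change (D n).s = axisPoint (F n a)
    induction n using Int.induction_on with
    | zero => rw [hF0, Equiv.swap_apply_left, hb]
    | succ n ih => rw [hs, hF', ih]
    | pred n ih =>
      have h1 := hs (-n - 1)
      have h2 := hF' (-n - 1)
      rw [sub_add_cancel] at h1 h2
      rw [h1, h2] at ih
      exact MulAction.injective _ ih

/-- The recursion for the frames fixes a universe up to right multiplication of all its frames by one
permutation; since the frames have to name the reference direction `a` as the triples prescribe,
this permutation fixes `a`. -/
theorem exists_determines {γ : ℝ → ModularCurve} (hγ : IsInfiniteGeodesic γ)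
    (hcusp : ¬ EndsAtCusp γ) (a : Axis) : ∃ U : MixmasterUniverse, Determines γ a U ∧
      ∀ V : MixmasterUniverse, Determines γ a V ↔ MixmasterUniverse.SameSolution a U V := by
  obtain ⟨D, hD, hDall⟩ := exists_codingOrbit hγ hcusp
  have hDi (n : ℤ) := mem_irrationalData_of_codes hγ hcusp (hD n).1
  obtain ⟨U, hU⟩ := exists_describes hDi (fun n => (hD n).2) a
  refine ⟨U, ⟨D, hD, hU⟩, fun V => ⟨?_, ?_⟩⟩
  · rintro ⟨E, hE, hV⟩
    have hEi (n : ℤ) := mem_irrationalData_of_codes hγ hcusp (hE n).1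
    obtain ⟨m, hm⟩ := (hDall _).1 (hE 0).1
    have hED := orbit_eq_of_eq (fun n => (hD n).2) hDi (fun n => (hE n).2) hEi hm
    have hu (n : ℤ) : (V.era n).u = (U.era (n + m)).u := by
      rw [(hV n).1, (hU _).1, hED]
    refine ⟨m, (U.era m).frame⁻¹ * (V.era 0).frame, ?_, fun n => ⟨hu n, ?_⟩⟩
    · have h1 := (hV 0).2
      rw [hm, (hU m).2] at h1
      rw [Equiv.Perm.mul_apply, ← axisPoint_bijective.1 h1]
      exact (U.era m).frame.symm_apply_apply a
    · induction n using Int.induction_on with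
      | zero => rw [zero_add, mul_inv_cancel_left]
      | succ n ih =>
        rw [add_right_comm, U.era_succ, V.era_succ]
        simp only
        rw [hu, ih, mul_assoc]
      | pred n ih =>
        have h1 := V.era_succ (-n - 1)
        have h2 := U.era_succ (-n - 1 + m)
        rw [sub_add_cancel] at h1
        rw [add_right_comm, sub_add_cancel] at h2
        rw [h1, h2] at ih
        simp only at ih
        rw [hu, mul_assoc] at ih
        exact mul_left_cancel ih
  · rintro ⟨m, τ, hτ, hUV⟩
    refine ⟨fun n => D (n + m), fun n => ⟨(hD _).1, ?_⟩, fun n => ⟨?_, ?_⟩⟩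
    · simp only
      rw [add_right_comm, (hD _).2]
    · rw [(hUV n).1, (hU _).1]
    · rw [(hUV n).2, Equiv.Perm.mul_apply, hτ, ← (hU _).2]

theorem kasnerExponent_sum {u : ℝ} (hu : 1 < u) (f : Equiv.Perm Axis) :
    ∑ b, kasnerExponent u (f b) = 1 ∧ ∑ b, kasnerExponent u (f b) ^ 2 = 1 := by
  have h0 : 1 + u + u ^ 2 ≠ 0 := by positivity
  rw [Equiv.sum_comp f (kasnerExponent u), Equiv.sum_comp f (fun b => kasnerExponent u b ^ 2)]
  have huniv : (Finset.univ : Finset Axis) = {.x, .y, .z} := rfl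
  constructor
  · rw [huniv, Finset.sum_insert (by decide), Finset.sum_pair (by decide)]
    simp only [kasnerExponent]
    field_simp
    ring
  · rw [huniv, Finset.sum_insert (by decide), Finset.sum_pair (by decide)]
    simp only [kasnerExponent]
    field_simp
    ring

/-! ### Continued fractions -/

/-- The digits of `w` after the integral part only depend on the fractional part of `w`; in this form
the statement carries over from `w` to `1 / fract w`. -/
theorem continuedFraction_ωp {D : ℤ → GeodesicData} (hDi : ∀ n, D n ∈ irrationalData)
    (hD : ∀ n, D (n + 1) = (D n).shift) (i : ℕ) : ∀ (n : ℤ) {w : ℝ}, Int.fract w = (D n).ωp →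
      (GenContFract.of w).s.get? i = some ⟨1, (⌊1 / (D (n + i)).ωp⌋ : ℝ)⟩ := by
  induction i with
  | zero =>
    intro n w hw
    have h := GenContFract.of_s_head (v := w) (by rw [hw]; exact (hDi n).2.2.ne_zero)
    rw [Nat.cast_zero, add_zero, one_div, ← hw]
    exact h
  | succ i ih =>
    intro n w hw
    rw [GenContFract.of_s_succ, hw, ih (n + 1)]
    · push_cast
      rw [add_assoc, add_comm 1 (i : ℤ)]
    · rw [hD, ← one_div]
      rfl

theorem floor_neg_ωm {D : ℤ → GeodesicData} (hDi : ∀ n, D n ∈ irrationalData)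
    (hD : ∀ n, D (n + 1) = (D n).shift) (n : ℤ) :
    ⌊-(D n).ωm⌋ = ⌊1 / (D (n - 1)).ωp⌋ := by
  rw [← floor_neg_shift (hDi (n - 1)), ← hD, sub_add_cancel]

theorem fract_neg_ωm {D : ℤ → GeodesicData} (hDi : ∀ n, D n ∈ irrationalData)
    (hD : ∀ n, D (n + 1) = (D n).shift) (n : ℤ) :
    Int.fract (-(D n).ωm) = (-(D (n - 1)).ωm)⁻¹ := by
  rw [Int.fract, floor_neg_ωm hDi hD]
  have h := hD (n - 1)
  rw [sub_add_cancel] at h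
  rw [h]
  simp only [GeodesicData.shift]
  rw [one_div, inv_neg]
  ring

theorem continuedFraction_ωm {D : ℤ → GeodesicData} (hDi : ∀ n, D n ∈ irrationalData)
    (hD : ∀ n, D (n + 1) = (D n).shift) (i : ℕ) : ∀ (n : ℤ) {w : ℝ},
      Int.fract w = (-(D n).ωm)⁻¹ →
      (GenContFract.of w).s.get? i = some ⟨1, (⌊1 / (D (n - 1 - i)).ωp⌋ : ℝ)⟩ := by
  induction i with
  | zero =>
    intro n w hw
    have h := GenContFract.of_s_head (v := w)
      (by rw [hw]; exact inv_ne_zero (neg_ne_zero.2 (hDi n).2.1.ne_zero))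
    rw [Nat.cast_zero, sub_zero, ← floor_neg_ωm hDi hD, ← inv_inv (-(D n).ωm), ← hw]
    exact h
  | succ i ih =>
    intro n w hw
    rw [GenContFract.of_s_succ, hw, inv_inv, ih (n - 1) (fract_neg_ωm hDi hD n)]
    push_cast
    rw [add_comm (i : ℤ) 1, ← sub_sub]

end Mixmaster

theorem theorem1 :
    -- the labels of the axes, and the action of the matrix `(-k 1; 1 0)` on them
    Function.Bijective axisPoint ∧
    (∀ (k : ℤ) (b : Axis), Even k →
      shiftElement k • axisPoint b = axisPoint (Equiv.swap Axis.y Axis.z b)) ∧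
    (∀ (k : ℤ) (b : Axis), Odd k →
      shiftElement k • axisPoint b =
        axisPoint ((Equiv.swap Axis.y Axis.z * Equiv.swap Axis.x Axis.y) b)) ∧
    -- the shift is invertible on the data without cuspidal end points
    Set.BijOn GeodesicData.shift irrationalData irrationalData ∧
    -- all these data code geodesics that do not end at cusps
    (∀ d ∈ irrationalData, ∃ γ : ℝ → ModularCurve,
      IsInfiniteGeodesic γ ∧ ¬ EndsAtCusp γ ∧ Codes d γ) ∧
    ∀ γ : ℝ → ModularCurve, IsInfiniteGeodesic γ → ¬ EndsAtCusp γ →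
      -- the data that code `γ` form exactly one two-sided orbit of the shift
      (∃ D : ℤ → GeodesicData, IsCodingOrbit D γ ∧ ∀ d, Codes d γ ↔ ∃ n, d = D n) ∧
      (∀ d, Codes d γ → d ∈ irrationalData) ∧
      -- and they determine `γ` up to the choice of the origin of its parameter
      (∀ γ' : ℝ → ModularCurve, IsInfiniteGeodesic γ' → ¬ EndsAtCusp γ' →
        ((∃ d, Codes d γ ∧ Codes d γ') ↔ ∃ t₀ : ℝ, ∀ t, γ' t = γ (t + t₀))) ∧
      -- `γ` determines a mixmaster universe, which is unique
      (∀ a : Axis, ∃ U : MixmasterUniverse, Determines γ a U ∧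
        ∀ V : MixmasterUniverse, Determines γ a V ↔ MixmasterUniverse.SameSolution a U V) ∧
      -- the evolution of the universe is given by the shift
      ∀ (D : ℤ → GeodesicData) (a : Axis) (U : MixmasterUniverse), IsCodingOrbit D γ → Describes D a U →
        ∀ n : ℤ,
          -- transition of the parameter `u` and of the axes between Kasner eras
          (U.era (n + 1)).u = 1 / ((U.era n).u - ⌊(U.era n).u⌋) ∧
          (1 / (U.era (n + 1)).u, (D (n + 1)).s) = gaussShift (1 / (U.era n).u, (D n).s) ∧
          (∀ b, axisPoint ((U.era (n + 1)).frame b) =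
            shiftElement ⌊(U.era n).u⌋ • axisPoint ((U.era n).frame b)) ∧
          -- transition of the second parameter `v = -ω⁻`
          -(D (n + 1)).ωm = ⌊(U.era n).u⌋ + 1 / (-(D n).ωm) ∧
          -- the era consists of `[u]` cycles, each with a Kasner metric, and ends with a bounce
          (∀ j : ℕ, (j : ℤ) < ⌊(U.era n).u⌋ →
            1 < (KasnerCycle.next^[j] (U.era n)).u ∧
            ∑ b, (KasnerCycle.next^[j] (U.era n)).exponent b = 1 ∧
            ∑ b, (KasnerCycle.next^[j] (U.era n)).exponent b ^ 2 = 1) ∧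
          (∀ j : ℕ, (j : ℤ) = ⌊(U.era n).u⌋ →
            U.era (n + 1) = (KasnerCycle.next^[j] (U.era n)).bounce) ∧
          -- the continued fraction digits of `ω⁺` and `-ω⁻` are the numbers `[u]` of the eras
          (GenContFract.of (D n).ωp).h = 0 ∧
          (∀ i : ℕ, (GenContFract.of (D n).ωp).s.get? i =
            some ⟨1, (⌊(U.era (n + i)).u⌋ : ℝ)⟩) ∧
          (GenContFract.of (-(D n).ωm)).h = (⌊(U.era (n - 1)).u⌋ : ℝ) ∧
          (∀ i : ℕ, (GenContFract.of (-(D n).ωm)).s.get? i =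
            some ⟨1, (⌊(U.era (n - 2 - i)).u⌋ : ℝ)⟩) := by
  refine ⟨axisPoint_bijective, fun k b hk => shiftElement_smul_of_even hk b,
    fun k b hk => shiftElement_smul_of_odd hk b, shift_bijOn, fun d hd => exists_geodesic_of_mem hd,
    fun γ hγ hcusp => ⟨exists_codingOrbit hγ hcusp,
      fun d hd => mem_irrationalData_of_codes hγ hcusp hd,
      fun γ' _ _ => exists_common_codes_iff hγ hcusp, exists_determines hγ hcusp, ?_⟩⟩
  intro D a U hDγ hU n
  have hDi (n : ℤ) := mem_irrationalData_of_codes hγ hcusp (hDγ n).1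
  have hD (n : ℤ) := (hDγ n).2
  have hu (n : ℤ) : 1 / (D n).ωp = (U.era n).u := (hU n).1.symm
  have hinv (n : ℤ) : 1 / (U.era n).u = (D n).ωp := by rw [← hu, one_div_one_div]
  have hirr : Irrational (U.era n).u := by
    rw [← hu, one_div]; exact (hDi n).2.2.inv
  refine ⟨?_, ?_, ?_, ?_, ?_, fun j hj => U.era_succ_eq_bounce n hj, ?_, ?_, ?_, ?_⟩
  · rw [U.era_succ]
  · rw [hinv, hinv, hD]
    rfl
  · intro b
    rw [U.era_succ, shiftElement_smul_axisPoint]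
    rfl
  · rw [hD, ← hu]
    simp only [GeodesicData.shift]
    rw [one_div_neg_eq_neg_one_div]
    ring
  · intro j hj
    have h1 : ((j : ℝ) + 1) ≤ (⌊(U.era n).u⌋ : ℝ) := by exact_mod_cast hj
    have h2 : (⌊(U.era n).u⌋ : ℝ) < (U.era n).u :=
      lt_of_le_of_ne (Int.floor_le _) (hirr.ne_int _).symm
    have h3 : 1 < (KasnerCycle.next^[j] (U.era n)).u := by
      rw [KasnerCycle.next_iterate]
      simp only
      linarith
    exact ⟨h3, kasnerExponent_sum h3 _⟩
  · have h := mem_irrationalData_iff.1 (hDi n)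
    rw [GenContFract.of_h_eq_floor, Int.floor_eq_zero_iff.2 ⟨h.2.1.le, h.2.2.1⟩, Int.cast_zero]
  · intro i
    rw [← hu]
    refine continuedFraction_ωp hDi hD i n (Int.fract_eq_self.2 ?_)
    have h := mem_irrationalData_iff.1 (hDi n)
    exact ⟨h.2.1.le, h.2.2.1⟩
  · rw [GenContFract.of_h_eq_floor, floor_neg_ωm hDi hD, hu]
  · intro i
    rw [continuedFraction_ωm hDi hD i (n - 1) (fract_neg_ωm hDi hD n), hu, sub_sub n 1 1,
      one_add_one_eq_two]
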